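/- Let $\mathcal A=\{1,\dots,m\}$ and let $\mathbf a=(\zeta_n)_{n\ge1}$ be a sequence of substitutions $\zeta_n:\mathcal A\to\mathcal A^+$ (letters to non-empty words, extended by concatenation), such that for each $n$ every letter occurs in some $\zeta_n(a)$ and $|\zeta_n(a)|>1$ for some $a$. Put $\zeta^{[n]}=\zeta_1\circ\dots\circ\zeta_n$, $\mathsf S_\zeta(i,j)=\#\{\text{occurrences of } i \text{ in } \zeta(j)\}$, $\mathsf S_n=\mathsf S_{\zeta_n}$, $\mathsf S^{[n]}=\mathsf S_{\zeta^{[n]}}$, and let $\|\cdot\|$ be the maximal absolute column sum of a matrix. Let $X_{\mathbf a}\subset\mathcal A^{\mathbb Z}$ be the set of two-sided sequences all of whose finite subwords are subwords of some $\zeta^{[n]}(b)$, $n\ge 1$, $b\in\mathcal A$; let $T$ be the left shift and $\sigma^n\mathbf a=(\zeta_{n+j})_{j\ge1}$. Assume: * **(A1′)** there is a finite word $\mathbf q$ of substitutions whose product of substitution matrices is strictly positive, such that for every $\varepsilon>0$ there is $n_0$ such that for all $n\ge n_0$ the word $\mathbf q$ is a subword of $\zeta_{\lfloor n(1-\varepsilon)\rfloor+1},\dots,\zeta_n$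 (indices $<1$ being omitted); * **(A2)** the limit $\lambda_{\mathbf a}=\lim_{n\to\infty}\frac1n\log\|\mathsf S^{[n]}\|$ exists and is finite; * **(A3)** $\lim_{n\to\infty}\frac1n\log(1+\|\mathsf S_n\|)=0$; * **(aperiodicity)** $T$ has no periodic point in $X_{\mathbf a}$; * **(recognizability)** for every $n\ge1$, each $x\in X_{\mathbf a}$ has at most one representation $x=T^k(\zeta^{[n]}(x'))$ with $x'\in X_{\sigma^n\mathbf a}$ and $0\le k<|\zeta^{[n]}(x'_0)|$, where $\zeta(\dots a_{-1}.a_0a_1\dots)=\dots\zeta(a_{-1}).\zeta(a_0)\zeta(a_1)\dots$. Let $\mu$ be the $T$-invariant Borel probability measure on $X_{\mathbf a}$, let $\vec s\in\mathbb R^m$ have positive entries, and let $h_t$ be the suspension flow on $\{(x,t):x\in X_{\mathbf a},\,0\le t<s_{x_0}\}$ over $(X_{\mathbf a},T)$ with roof function $x\mapsto s_{x_0}$, with invariant probability measure $\widetilde\mu$, the normalized restriction of $\mu\times\mathrm{Lebesgue}$. Let $f(x,t)=\sum_{j}\mathbf 1_{[x_0=j]}\psi_j(t)$ with $\psi_j:[0,s_j]\to\mathbb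 C$ Lipschitz, and let $\sigma_f$ be its spectral measure, the finite Borel measure on $\mathbb R$ with $\int e^{2\pi i\omega t}\,d\sigma_f(\omega)=\langle f\circ h_t,f\rangle_{L^2(\widetilde\mu)}$ for all $t\in\mathbb R$. For a substitution $\zeta$ with $\zeta(b)=u_1^b\dots u_{|\zeta(b)|}^b$ and $\xi\in\mathbb R^m$ let $\mathscr M_\zeta(\xi)$ be the $m\times m$ matrix with entries $$\mathscr M_\zeta(\xi)_{b,c}=\sum_{j\le|\zeta(b)|,\ u_j^b=c}\exp\Bigl(-2\pi i\sum_{k=1}^{j-1}\xi_{u_k^b}\Bigr),$$ put $\mathscr M_{\mathbf a}(\xi,n)=\mathscr M_{\zeta_n}\bigl((\mathsf S^{[n-1]})^{t}\xi\bigr)\cdots\mathscr M_{\zeta_2}\bigl((\mathsf S^{[1]})^t\xi\bigr)\mathscr M_{\zeta_1}(\xi)$, and, for $\vec z\in\mathbb C^m$, $\chi^+_{\mathbf a,\xi,\vec z}=\limsup_{n\to\infty}\frac1n\log\|\mathscr M_{\mathbf a}(\xi,n)\vec z\|\in[-\infty,\infty)$. Let $$\underline d(\sigma_f,\omega)=\liminf_{r\to0+}\frac{\log\sigma_f(B_r(\omega))}{\log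 r}\in[0,\infty].$$ **Theorem.** Fix $\omega\in\mathbb R$, let $\xi\equiv\omega\vec s \pmod{\mathbb Z^m}$ and $\vec z=(\widehat\psi_j(\omega))_{j\in\mathcal A}$, where $\widehat\psi_j(\omega)=\int_0^{s_j}\psi_j(t)e^{-2\pi i\omega t}\,dt$. 1. If $\chi^+_{\mathbf a,\xi,\vec z}>0$, then $\underline d(\sigma_f,\omega)=2-\dfrac{2\chi^+_{\mathbf a,\xi,\vec z}}{\lambda_{\mathbf a}}$ (here automatically $\lambda_{\mathbf a}\ge\chi^+_{\mathbf a,\xi,\vec z}>0$). 2. If $\chi^+_{\mathbf a,\xi,\vec z}\le0$ and $\lambda_{\mathbf a}>0$, then $\underline d(\sigma_f,\omega)\ge2$. -/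

import Mathlib

open MeasureTheory Filter Topology
open scoped ENNReal

noncomputable section

namespace SAdic

/-- A substitution on the alphabet `Fin m`: a map from letters to nonempty finite words. -/
structure Subst (m : ℕ) where
  word : Fin m → List (Fin m)
  ne_nil : ∀ a, word a ≠ []

namespace Subst

variable {m : ℕ}

/-- Extension of a substitution to finite words by concatenation. -/
def onList (ζ : Subst m) (w : List (Fin m)) : List (Fin m) := w.flatMap ζ.word

/-- The trivial substitution `a ↦ a`. -/
def idSubst (m : ℕ) : Subst m := ⟨fun a => [a], fun a => List.cons_ne_nil a []⟩

/-- Composition `(ζ ∘ η)(a) = ζ(η(a))`. -/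
def comp (ζ η : Subst m) : Subst m where
  word a := ζ.onList (η.word a)
  ne_nil a := by
    obtain ⟨b, hb⟩ := List.exists_mem_of_ne_nil _ (η.ne_nil a)
    obtain ⟨c, hc⟩ := List.exists_mem_of_ne_nil _ (ζ.ne_nil b)
    exact List.ne_nil_of_mem (List.mem_flatMap.2 ⟨b, hb, hc⟩)

/-- The substitution matrix: `S(i,j)` is the number of symbols `i` in the word `ζ(j)`. -/
def matrix (ζ : Subst m) : Matrix (Fin m) (Fin m) ℝ :=
  Matrix.of fun i j => ((ζ.word j).count i : ℝ)

/-- The class of admissible substitutions: all letters appear in the words `ζ(a)`,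
and some `ζ(a)` has length greater than one. -/
def Admissible (ζ : Subst m) : Prop :=
  (∀ c, ∃ a, c ∈ ζ.word a) ∧ ∃ a, 1 < (ζ.word a).length

/-- Concatenation of `N` nonempty words has length at least `N`. -/
theorem le_length_flatMap_range (F : ℕ → List (Fin m)) (hF : ∀ k, F k ≠ []) (N : ℕ) :
    N ≤ ((List.range N).flatMap F).length := by
  induction N with
  | zero => simp
  | succ N ih =>
    have h := List.length_pos_iff.2 (hF N)
    simp only [List.range_succ, List.flatMap_append, List.length_append, List.flatMap_singleton]
    omega

/-- The action on bi-infinite sequences,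
`ζ(… x₋₁ . x₀ x₁ …) = … ζ(x₋₁) . ζ(x₀) ζ(x₁) …`, with `ζ(x₀)` starting at the origin.
The entry with index `i ≥ 0` is read from `ζ(x₀) … ζ(xᵢ)`, and the entry with index `-(i+1)`
is read backwards from `ζ(x₋₍ᵢ₊₁₎) … ζ(x₋₁)`. -/
def onBiinf (ζ : Subst m) (x : ℤ → Fin m) : ℤ → Fin m
  | Int.ofNat i =>
      ((List.range (i + 1)).flatMap fun k : ℕ => ζ.word (x (k : ℤ)))[i]'
        (le_length_flatMap_range _ (fun _ => ζ.ne_nil _) (i + 1))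
  | Int.negSucc i =>
      ((List.range (i + 1)).flatMap fun k : ℕ => (ζ.word (x (Int.negSucc k))).reverse)[i]'
        (le_length_flatMap_range _ (fun _ h => ζ.ne_nil _ (List.reverse_eq_nil_iff.1 h)) (i + 1))

/-- The matrix-valued function `M_ζ(ξ)`: if `ζ(b) = u₁ … u_ℓ`, its `(b,c)` entry is the sum over
all `j` with `u_j = c` of `exp(-2πi (ξ_{u₁} + … + ξ_{u_{j-1}}))`. -/
def cocycleMatrix (ζ : Subst m) (ξ : Fin m → ℝ) : Matrix (Fin m) (Fin m) ℂ :=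
  Matrix.of fun b c => ∑ j : Fin (ζ.word b).length,
    if (ζ.word b).get j = c then
      Complex.exp (-2 * Real.pi * Complex.I * (((((ζ.word b).take j).map ξ).sum : ℝ) : ℂ))
    else 0

end Subst

variable {m : ℕ}

/-- The matrix norm `‖M‖₁`: the maximal absolute column sum. -/
def norm1 (M : Matrix (Fin m) (Fin m) ℝ) : ℝ := ⨆ j, ∑ i, |M i j|

/- A sequence of substitutions `ζ₁, ζ₂, …` is represented by `a : ℕ → Subst m` with
`ζ_{n+1} = a n`. -/

/-- `ζ^{[n]} = ζ₁ ∘ ⋯ ∘ ζₙ`. -/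
def iter (a : ℕ → Subst m) : ℕ → Subst m
  | 0 => Subst.idSubst m
  | n + 1 => (iter a n).comp (a n)

/-- The left shift `T` on bi-infinite sequences. -/
def shift (x : ℤ → Fin m) : ℤ → Fin m := fun i => x (i + 1)

/-- The space `X_a` of bi-infinite sequences all of whose finite subwords appear as subwords of
some `ζ^{[n]}(b)`, `n ≥ 1`. -/
def space (a : ℕ → Subst m) : Set (ℤ → Fin m) :=
  {x | ∀ (i : ℤ) (L : ℕ), ∃ n ≥ 1, ∃ b : Fin m,
    (List.ofFn fun k : Fin L => x (i + (k : ℕ))) <:+: (iter a n).word b}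

/-- The shift `T` has no periodic points in `X_a`. -/
def Aperiodic (a : ℕ → Subst m) : Prop :=
  ∀ x ∈ space a, ∀ p ≥ 1, shift^[p] x ≠ x

/-- Recognizability: for every `n ≥ 1`, a point of `X_a` has at most one representation
`x = T^k(ζ^{[n]}(x'))` with `x' ∈ X_{σⁿ a}` and `0 ≤ k < |ζ^{[n]}(x'₀)|`. -/
def Recognizable (a : ℕ → Subst m) : Prop :=
  ∀ n ≥ 1, ∀ x ∈ space a,
    ∀ y ∈ space (fun i => a (n + i)), ∀ y' ∈ space (fun i => a (n + i)), ∀ k k' : ℕ,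
      k < ((iter a n).word (y 0)).length → k' < ((iter a n).word (y' 0)).length →
      x = shift^[k] ((iter a n).onBiinf y) → x = shift^[k'] ((iter a n).onBiinf y') →
      k = k' ∧ y = y'

/-- Condition (A1'): there is a finite word `q` of substitutions whose matrix product is strictly
positive such that for every `ε > 0` and all large `n`, the word `q` appears as a subword of
`ζ_{⌊n(1-ε)⌋+1}, …, ζ_n`. -/
def CondA1' (a : ℕ → Subst m) : Prop :=
  ∃ q : List (Subst m), (∀ i j, 0 < (q.map Subst.matrix).prod i j) ∧
    ∀ ε : ℝ, 0 < ε → ∃ n₀ : ℕ, ∀ n ≥ n₀,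
      q <:+: (List.Ico ⌊(n : ℝ) * (1 - ε)⌋₊ n).map a

/-- Condition (A2), with the value of the limit:
`λ_a = lim (1/n) log ‖S^{[n]}‖` exists and is finite. -/
def CondA2 (a : ℕ → Subst m) (lam : ℝ) : Prop :=
  Tendsto (fun n : ℕ => 1 / (n : ℝ) * Real.log (norm1 (iter a n).matrix)) atTop (𝓝 lam)

/-- Condition (A3): `(1/n) log (1 + ‖S_n‖) → 0`. -/
def CondA3 (a : ℕ → Subst m) : Prop :=
  Tendsto (fun n : ℕ => 1 / ((n : ℝ) + 1) * Real.log (1 + norm1 (a n).matrix)) atTop (𝓝 0)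

/-- The spectral cocycle
`M_a(ξ,n) = M_{ζ_n}((S^{[n-1]})ᵗ ξ) ⋯ M_{ζ_2}((S^{[1]})ᵗ ξ) M_{ζ_1}(ξ)`. -/
def cocycle (a : ℕ → Subst m) (ξ : Fin m → ℝ) : ℕ → Matrix (Fin m) (Fin m) ℂ
  | 0 => 1
  | n + 1 => (a n).cocycleMatrix ((iter a n).matrix.transpose.mulVec ξ) * cocycle a ξ n

/-- The pointwise upper Lyapunov exponent `χ⁺_{a,ξ,z} = limsup (1/n) log ‖M_a(ξ,n) z‖`, an extended
real number (`log 0 = -∞`). -/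
def upperExponent (a : ℕ → Subst m) (ξ : Fin m → ℝ) (z : Fin m → ℂ) : EReal :=
  limsup (fun n : ℕ => ENNReal.log ‖(cocycle a ξ n).mulVec z‖ₑ / ((n : ℝ) : EReal)) atTop

/-- The Birkhoff sums of the roof function `x ↦ s (x 0)`:
`s(x₀) + ⋯ + s(x_{n-1})` for `n ≥ 0` and `-(s(x_n) + ⋯ + s(x₋₁))` for `n < 0`. -/
def roofSum (s : Fin m → ℝ) (x : ℤ → Fin m) (n : ℤ) : ℝ :=
  ∑ i ∈ Finset.Ico 0 n, s (x i) - ∑ i ∈ Finset.Ico n 0, s (x i)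

/-- The number of the floor reached from `(x,0)` after (signed) time `u`: the integer `n` with
`roofSum s x n ≤ u < roofSum s x (n+1)` (see `existsUnique_floor`). -/
def floorIndex (s : Fin m → ℝ) (x : ℤ → Fin m) (u : ℝ) : ℤ :=
  Classical.epsilon fun n : ℤ => roofSum s x n ≤ u ∧ u < roofSum s x (n + 1)

/-- The phase space of the suspension flow with roof function `s (x 0)`, as the set of `(x,t)` with
`0 ≤ t < s (x 0)` (the base `X_a` carries the measure on the first factor). -/
def suspension (s : Fin m → ℝ) : Set ((ℤ → Fin m) × ℝ) :=
  {p | 0 ≤ p.2 ∧ p.2 < s (p.1 0)}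

/-- The suspension flow `h_τ(x,t) = (Tⁿ x, t + τ - roofSum s x n)`, where `n` is the integer for
which the second coordinate lies in `[0, s((Tⁿx)₀))`. -/
def flow (s : Fin m → ℝ) (τ : ℝ) (p : (ℤ → Fin m) × ℝ) : (ℤ → Fin m) × ℝ :=
  let n := floorIndex s p.1 (p.2 + τ)
  (fun i => p.1 (i + n), p.2 + τ - roofSum s p.1 n)

/-- The flow-invariant probability measure on the suspension: the normalized restriction of
`μ × Lebesgue`. -/
def suspMeasure (s : Fin m → ℝ) (μ : Measure (ℤ → Fin m)) : Measure ((ℤ → Fin m) × ℝ) :=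
  ((μ.prod volume) (suspension s))⁻¹ • (μ.prod volume).restrict (suspension s)

/-- `μ` is a shift-invariant Borel probability measure on `X_a`. -/
structure IsInvariantProb (a : ℕ → Subst m) (μ : Measure (ℤ → Fin m)) : Prop where
  prob : IsProbabilityMeasure μ
  supported : μ (space a)ᶜ = 0
  invariant : MeasurePreserving shift μ μ

/-- The function `f(x,t) = ∑_j 1_{[j]}(x) ψ_j(t)` on the suspension. -/
def cylindrical (ψ : Fin m → ℝ → ℂ) (p : (ℤ → Fin m) × ℝ) : ℂ :=
  ∑ j, if p.1 0 = j then ψ j p.2 else 0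

/-- `σ` is the spectral measure of `f` for the flow `(h_t)` on `(Y, ν)`: the finite Borel measure
on `ℝ` with `∫ e^{2πi ω t} dσ(ω) = ⟨f ∘ h_t, f⟩` for all real `t`. -/
structure IsSpectralMeasure {Y : Type*} [MeasurableSpace Y] (ν : Measure Y) (h : ℝ → Y → Y)
    (f : Y → ℂ) (σ : Measure ℝ) : Prop where
  finite : IsFiniteMeasure σ
  fourier : ∀ t : ℝ,
    ∫ ω : ℝ, Complex.exp (2 * Real.pi * Complex.I * (ω : ℂ) * (t : ℂ)) ∂σ
      = ∫ y, f (h t y) * (starRingEnd ℂ) (f y) ∂ν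

/-- The lower local dimension `liminf_{r → 0+} log σ(B_r(ω)) / log r`, an extended real number
(it is `+∞` outside the support). -/
def lowerLocalDim (σ : Measure ℝ) (ω : ℝ) : EReal :=
  liminf (fun r : ℝ => ENNReal.log (σ (Metric.ball ω r)) / ((Real.log r : ℝ) : EReal)) (𝓝[>] 0)

/-- The Fourier transform at `ω` of `ψ` considered as a function on `[0,s]`. -/
def fourierOn (s : ℝ) (ψ : ℝ → ℂ) (ω : ℝ) : ℂ :=
  ∫ t in (0 : ℝ)..s, ψ t * Complex.exp (-2 * Real.pi * Complex.I * (ω : ℂ) * (t : ℂ))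

theorem roofSum_succ (s : Fin m → ℝ) (x : ℤ → Fin m) (n : ℤ) :
    roofSum s x (n + 1) = roofSum s x n + s (x n) := by
  unfold roofSum
  rcases le_or_gt 0 n with h | h
  · rw [Finset.Ico_eq_empty (a := n + 1) (by omega), Finset.Ico_eq_empty (a := n) (by omega)]
    have : Finset.Ico 0 (n + 1) = insert n (Finset.Ico 0 n) := by ext; simp; omega
    rw [this, Finset.sum_insert (by simp)]
    ring
  · rw [Finset.Ico_eq_empty (a := 0) (b := n + 1) (by omega),
      Finset.Ico_eq_empty (a := 0) (b := n) (by omega)]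
    have : Finset.Ico n 0 = insert n (Finset.Ico (n + 1) 0) := by ext; simp; omega
    rw [this, Finset.sum_insert (by simp)]
    ring

/-- The integer in the definition of the flow exists and is unique when the roof is positive. -/
theorem existsUnique_floor (s : Fin m → ℝ) (hs : ∀ j, 0 < s j) (x : ℤ → Fin m) (u : ℝ) :
    ∃! n : ℤ, roofSum s x n ≤ u ∧ u < roofSum s x (n + 1) := by
  have hmono : StrictMono (roofSum s x) :=
    strictMono_int_of_lt_succ fun n => by rw [roofSum_succ]; linarith [hs (x n)]
  have : Nonempty (Fin m) := ⟨x 0⟩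
  obtain ⟨j₀, hj₀⟩ := Finite.exists_min s
  have hc := hs j₀
  have hup : ∀ k : ℕ, (k : ℝ) * s j₀ ≤ roofSum s x k := by
    intro k
    induction k with
    | zero => simp [roofSum]
    | succ k ih => push_cast; rw [roofSum_succ]; linarith [hj₀ (x k)]
  have hdn : ∀ k : ℕ, roofSum s x (-(k : ℤ)) ≤ -((k : ℝ) * s j₀) := by
    intro k
    induction k with
    | zero => simp [roofSum]
    | succ k ih =>
      have := roofSum_succ s x (-((k + 1 : ℕ) : ℤ))
      rw [show -((k + 1 : ℕ) : ℤ) + 1 = -(k : ℤ) by push_cast; ring] at this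
      have h2 := hj₀ (x (-((k + 1 : ℕ) : ℤ)))
      push_cast at *
      linarith
  obtain ⟨k, hk⟩ := exists_nat_gt (|u| / s j₀)
  rw [div_lt_iff₀ hc] at hk
  obtain ⟨n, hn, hmax⟩ := Int.exists_greatest_of_bdd (P := fun n => roofSum s x n ≤ u)
    ⟨k, fun z hz => by
      by_contra hlt
      have := hmono (not_le.1 hlt)
      linarith [hup k, le_abs_self u]⟩
    ⟨-(k : ℤ), by linarith [hdn k, neg_abs_le u]⟩
  refine ⟨n, ⟨hn, ?_⟩, ?_⟩
  · by_contra hle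
    have := hmax (n + 1) (not_lt.1 hle)
    omega
  · rintro n' ⟨h1, h2⟩
    have hle := hmax n' h1
    have hlt : n < n' + 1 := hmono.lt_iff_lt.1 (lt_of_le_of_lt hn h2)
    omega

end SAdic

end

/-!
The lower local dimension of the spectral measure `σ` at `ω` is read off from the mean square of the
twisted integrals `∫_0^R e^{-2πiωτ} f(h_τ y) dτ`. Since the suspension measure is flow-invariant,
this mean square is the integral against `σ` of the kernel `|∫_0^R e^{-2πi(ω-θ)τ} dτ|²`
(`meanSquare_eq`). That kernel is at least `R²/4` for `|θ - ω| ≤ 1/(2πR)`, so bounds `O(R^β)`, uniform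
over orbits, for the twisted integrals give `σ(B_r(ω)) = O(r^{2-2β})` (`le_lowerLocalDim`). In the
other direction, the kernel is at most `R²` on `B_r(ω)`, and outside this ball it is bounded by the
average of the same kernels over the scales up to `1/r`; hence the mean square at scale `R` is at
most `R² σ(B_r(ω)) + O(r^{-2β})` (`meanSquare_le_ball`).

Up to bounded boundary terms, a twisted integral along an orbit is a twisted sum over the word of
the floors visited, and the twisted sum over `ζ^{[n]}(b)` is the `b`-th coordinate of `M_a(ξ,n)z`
(`twistedSum_iter_word`). A word of the language is cut into images of letters of all levels up to
some `N`; the number of pieces of level `n` is at most of order `‖S_{n+1}‖`, which is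
subexponential, and all the words `ζ^{[n]}(b)` have length `e^{(λ+o(1))n}`, by the positive blocks of
`CondA1'`. So the twisted integrals are `O(R^β)` for every `β > max(χ,0)/λ`
(`exists_norm_twistedSum_factor_le`), which gives the lower bounds for the dimension.

If `χ > 0`, then for infinitely many `n` some word `w = ζ^{[n]}(b)` has a twisted sum of modulus
`A ≥ e^{(χ-δ)n}`. The bound `O(R^β)` at smaller scales shows that moving both ends of the
interval by `e^{(λ-o(1))n}` changes the twisted integral by at most `A/2`
(`half_le_norm_integral_of_recentOccurrence`). As `w` occurs in every word of the language of
length `e^{(λ+o(1))n}` (`exists_occurrence`), the points to which this applies have measure at least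
`e^{-o(n)}` (`le_measure_recentOccurrence`). So the mean square over the length of `w` is at
least `e^{(2χ-o(1))n}`, and taking `r = e^{-(λ-θ)n}` with small `θ > 0` makes the tail `O(r^{-2β})`
negligible (`lowerLocalDim_le`).
-/

namespace SAdic

namespace Subst

variable {m : ℕ}

/-! ### Substitutions, words of the language and desubstitution -/

theorem ext_word {ζ η : Subst m} (h : ∀ b, ζ.word b = η.word b) : ζ = η := by
  cases ζ; cases η
  congr
  exact funext h

theorem onList_comp (ζ η : Subst m) (w : List (Fin m)) :
    (ζ.comp η).onList w = ζ.onList (η.onList w) :=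
  (List.flatMap_assoc).symm

theorem onList_idSubst (w : List (Fin m)) : (idSubst m).onList w = w := by
  simp [onList, idSubst]

/-- Substitutions form a monoid under composition, so that `iter a n` is a product. -/
instance : Monoid (Subst m) where
  mul := comp
  one := idSubst m
  mul_assoc ζ η θ := ext_word fun _ => onList_comp ζ η _
  one_mul _ := ext_word fun _ => onList_idSubst _
  mul_one ζ := ext_word fun b => List.flatMap_singleton ζ.word b

theorem onList_mul (ζ η : Subst m) (w : List (Fin m)) :
    (ζ * η).onList w = ζ.onList (η.onList w) := onList_comp ζ η w

theorem onList_one (w : List (Fin m)) : (1 : Subst m).onList w = w := onList_idSubst w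

theorem word_mul (ζ η : Subst m) (b : Fin m) : (ζ * η).word b = ζ.onList (η.word b) := rfl

theorem word_one (b : Fin m) : (1 : Subst m).word b = [b] := rfl

theorem onList_nil (ζ : Subst m) : ζ.onList [] = [] := rfl

theorem onList_cons (ζ : Subst m) (c : Fin m) (w : List (Fin m)) :
    ζ.onList (c :: w) = ζ.word c ++ ζ.onList w := by simp [onList]

theorem onList_append (ζ : Subst m) (v w : List (Fin m)) :
    ζ.onList (v ++ w) = ζ.onList v ++ ζ.onList w := by simp [onList]

theorem onList_singleton (ζ : Subst m) (c : Fin m) : ζ.onList [c] = ζ.word c := by simp [onList]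

theorem word_infix_onList {ζ : Subst m} {b : Fin m} {w : List (Fin m)} (h : b ∈ w) :
    ζ.word b <:+: ζ.onList w := by
  obtain ⟨p, q, rfl⟩ := List.append_of_mem h
  exact ⟨ζ.onList p, ζ.onList q, by simp [onList_append, onList_cons]⟩

/-- Every letter occurs in the image of some letter. -/
def Covers (ζ : Subst m) : Prop := ∀ c, ∃ b, c ∈ ζ.word b

theorem covers_one : (1 : Subst m).Covers := fun c => ⟨c, List.mem_singleton_self c⟩

theorem Covers.mul {ζ η : Subst m} (hζ : ζ.Covers) (hη : η.Covers) : (ζ * η).Covers := by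
  intro c
  obtain ⟨b, hb⟩ := hζ c
  obtain ⟨d, hd⟩ := hη b
  exact ⟨d, List.mem_flatMap.2 ⟨b, hd, hb⟩⟩

theorem covers_prod {l : List (Subst m)} (h : ∀ ζ ∈ l, ζ.Covers) : l.prod.Covers := by
  induction l with
  | nil => exact covers_one
  | cons ζ l ih =>
    rw [List.prod_cons]
    exact (h ζ (by simp)).mul (ih fun η hη => h η (by simp [hη]))

theorem count_onList (ζ : Subst m) (i : Fin m) (w : List (Fin m)) :
    (ζ.onList w).count i = ∑ k, (ζ.word k).count i * w.count k := by
  induction w with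
  | nil => simp [onList_nil]
  | cons c w ih =>
    rw [onList_cons, List.count_append, ih]
    simp_rw [List.count_cons, mul_add, Finset.sum_add_distrib]
    simp [add_comm]

theorem matrix_mul (ζ η : Subst m) : (ζ * η).matrix = ζ.matrix * η.matrix := by
  ext i j
  simp [matrix, Matrix.mul_apply, word_mul, count_onList]

theorem matrix_one : (1 : Subst m).matrix = 1 := by
  ext i j
  simp only [matrix, word_one, Matrix.one_apply, Matrix.of_apply]
  rcases eq_or_ne i j with rfl | h
  · simp
  · simp [h, h.symm]

theorem matrix_prod (l : List (Subst m)) : l.prod.matrix = (l.map matrix).prod := by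
  induction l with
  | nil => simp [matrix_one]
  | cons ζ l ih => simp [matrix_mul, ih]

theorem matrix_pos_iff {ζ : Subst m} {i j : Fin m} : 0 < ζ.matrix i j ↔ i ∈ ζ.word j := by
  simp [matrix, List.count_pos_iff]

theorem norm1_matrix (ζ : Subst m) :
    norm1 ζ.matrix = ⨆ j, ((ζ.word j).length : ℝ) := by
  have h (w : List (Fin m)) : ∑ i, w.count i = w.length := by
    induction w with
    | nil => simp
    | cons c w ih => simp [List.count_cons, Finset.sum_add_distrib, ih]
  unfold norm1
  congr 1
  ext j
  rw [← h]
  simp [matrix]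

theorem length_word_le_norm1 (ζ : Subst m) (j : Fin m) :
    ((ζ.word j).length : ℝ) ≤ norm1 ζ.matrix := by
  rw [norm1_matrix]
  exact le_ciSup (f := fun j => ((ζ.word j).length : ℝ)) (Set.finite_range _).bddAbove j

theorem exists_length_word_eq_norm1 [Nonempty (Fin m)] (ζ : Subst m) :
    ∃ j, ((ζ.word j).length : ℝ) = norm1 ζ.matrix := by
  rw [norm1_matrix]
  exact exists_eq_ciSup_of_finite (f := fun j => ((ζ.word j).length : ℝ))

theorem one_le_length_word (ζ : Subst m) (j : Fin m) : 1 ≤ (ζ.word j).length :=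
  List.length_pos_iff.2 (ζ.ne_nil j)

theorem norm1_matrix_nonneg (ζ : Subst m) : 0 ≤ norm1 ζ.matrix := by
  rw [norm1_matrix]
  exact Real.iSup_nonneg fun _ => Nat.cast_nonneg _

/-- A prefix of `ζ(w)` consists of the image of a prefix of `w` and a prefix of the image of
a letter. -/
theorem exists_of_prefix_onList (ζ : Subst m) {p w : List (Fin m)} (h : p <+: ζ.onList w) :
    ∃ w' p', p = ζ.onList w' ++ p' ∧ w' <+: w ∧ (p' = [] ∨ ∃ c, p' <+: ζ.word c) := by
  induction w generalizing p with
  | nil =>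
    rw [onList_nil, List.prefix_nil] at h
    exact ⟨[], [], by simp [h, onList_nil], by simp, Or.inl rfl⟩
  | cons c w ih =>
    rw [onList_cons] at h
    rcases List.prefix_or_prefix_of_prefix h (List.prefix_append _ _) with h' | ⟨t, rfl⟩
    · exact ⟨[], p, by simp [onList_nil], by simp, Or.inr ⟨c, h'⟩⟩
    · have ht : t <+: ζ.onList w := (List.prefix_append_right_inj _).1 h
      obtain ⟨w', p', rfl, hw, hp⟩ := ih ht
      exact ⟨c :: w', p', by simp [onList_cons], by simpa using hw, hp⟩

/-- A word no longer than the images of the letters meets at most two consecutive images. -/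
theorem exists_infix_onList_pair (ζ : Subst m) {v w : List (Fin m)} (h : v <:+: ζ.onList w)
    (hv : ∀ c, v.length ≤ (ζ.word c).length) :
    ∃ w', w'.length ≤ 2 ∧ v <:+: ζ.onList w' := by
  induction w with
  | nil => exact ⟨[], by simp, h⟩
  | cons c w ih =>
    obtain ⟨p, q, hpq⟩ := h
    rw [onList_cons, List.append_assoc] at hpq
    rcases List.append_eq_append_iff.1 hpq with ⟨t, ht, htq⟩ | ⟨t, ht, htq⟩
    · -- the image of the first letter contains the part before `v`
      cases w with
      | nil =>
        exact ⟨[c], by simp, p, q, by rw [onList_singleton, ht]; simpa [onList_nil] using htq⟩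
      | cons d w =>
        refine ⟨[c, d], by simp, p, ?_⟩
        have h1 : v <+: t ++ ζ.word d := by
          refine List.prefix_of_prefix_length_le (l₃ := t ++ ζ.onList (d :: w))
            ⟨q, htq⟩ ?_ ?_
          · rw [onList_cons, ← List.append_assoc]
            exact List.prefix_append _ _
          · have := hv d
            simp only [List.length_append]; omega
        obtain ⟨q', hq'⟩ := h1
        exact ⟨q', by simp [onList_cons, onList_nil, ht, ← hq']⟩
    · exact ih ⟨t, q, by rw [htq, List.append_assoc]⟩

/-- A word that is twice as long as all the images of letters contains one of them. -/
theorem exists_word_infix_of_long (ζ : Subst m) {v w : List (Fin m)} (h : v <:+: ζ.onList w)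
    {L : ℕ} (hL : ∀ c, (ζ.word c).length ≤ L) (hv : 2 * L ≤ v.length) (hv0 : v ≠ []) :
    ∃ c, ζ.word c <:+: v := by
  induction w with
  | nil => simp [onList_nil] at h; exact absurd h hv0
  | cons c w ih =>
    obtain ⟨p, q, hpq⟩ := h
    rw [onList_cons, List.append_assoc] at hpq
    have hc := hL c
    have hc1 := ζ.one_le_length_word c
    rcases List.append_eq_append_iff.1 hpq with ⟨t, ht, htq⟩ | ⟨t, ht, htq⟩
    · have htl : t.length ≤ L := by rw [ht] at hc; simp at hc; omega
      have htv : t <+: v := List.prefix_of_prefix_length_le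
        (List.prefix_append t (ζ.onList w)) ⟨q, htq⟩ (by omega)
      obtain ⟨v', rfl⟩ := htv
      rw [List.append_assoc] at htq
      have hv' := List.append_cancel_left htq
      simp only [List.length_append] at hv
      cases w with
      | nil => simp [onList_nil] at hv'; simp [hv'.1] at hv; omega
      | cons d w =>
        refine ⟨d, ?_⟩
        rw [onList_cons] at hv'
        have : ζ.word d <+: v' := List.prefix_of_prefix_length_le
          (List.prefix_append _ (ζ.onList w)) ⟨q, hv'⟩ (by have := hL d; omega)
        exact this.isInfix.trans (List.suffix_append _ _).isInfix
    · exact ih ⟨t, q, by rw [htq, List.append_assoc]⟩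

end Subst

variable {m : ℕ}

theorem iter_succ (a : ℕ → Subst m) (n : ℕ) : iter a (n + 1) = iter a n * a n := rfl

theorem iter_eq_mul (a : ℕ → Subst m) {k n : ℕ} (h : k ≤ n) :
    iter a n = iter a k * ((List.Ico k n).map a).prod := by
  induction n, h using Nat.le_induction with
  | base => simp
  | succ n hn ih =>
    rw [iter_succ, ih, List.Ico.succ_top hn, List.map_append, List.prod_append, mul_assoc]
    simp

/-- The word `x_i x_{i+1} … x_{i+ℓ-1}`. -/
def factor (x : ℤ → Fin m) (i : ℤ) (ℓ : ℕ) : List (Fin m) :=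
  List.ofFn fun k : Fin ℓ => x (i + (k : ℕ))

theorem length_factor (x : ℤ → Fin m) (i : ℤ) (ℓ : ℕ) : (factor x i ℓ).length = ℓ := by
  simp [factor]

theorem factor_succ (x : ℤ → Fin m) (i : ℤ) (ℓ : ℕ) :
    factor x i (ℓ + 1) = factor x i ℓ ++ [x (i + ℓ)] := by
  simp only [factor]
  rw [List.ofFn_succ_last]
  simp

theorem factor_add (x : ℤ → Fin m) (i : ℤ) (j k : ℕ) :
    factor x i (j + k) = factor x i j ++ factor x (i + j) k := by
  induction k with
  | zero => simp [factor]
  | succ k ih => rw [← add_assoc, factor_succ, ih, factor_succ]; simp [add_assoc]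

/-- A word occurring in `x_i … x_{i+ℓ-1}` occurs at a position of this window. -/
theorem exists_factor_eq_of_infix {x : ℤ → Fin m} {i : ℤ} {ℓ : ℕ} {v : List (Fin m)}
    (h : v <:+: factor x i ℓ) :
    ∃ j : ℕ, j + v.length ≤ ℓ ∧ factor x (i + j) v.length = v := by
  obtain ⟨p, q, h⟩ := h
  have hl := congrArg List.length h
  simp only [List.length_append, length_factor] at hl
  refine ⟨p.length, by omega, ?_⟩
  have : ℓ = p.length + (v.length + q.length) := by omega
  rw [this, factor_add, factor_add, List.append_assoc] at h
  have h1 := (List.append_inj h (length_factor _ _ _).symm).2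
  exact ((List.append_inj h1 (length_factor _ _ _).symm).1).symm

theorem covers_block {a : ℕ → Subst m} (hadm : ∀ n, (a n).Admissible) (k n : ℕ) :
    ((List.Ico k n).map a).prod.Covers :=
  Subst.covers_prod fun ζ hζ => by
    obtain ⟨i, -, rfl⟩ := List.mem_map.1 hζ
    exact (hadm i).1

/-- Words of the language are desubstituted at every level. -/
theorem exists_factor_infix {a : ℕ → Subst m} (hadm : ∀ n, (a n).Admissible) {x : ℤ → Fin m}
    (hx : x ∈ space a) (i : ℤ) (ℓ N : ℕ) :
    ∃ w, factor x i ℓ <:+: (iter a N).onList w := by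
  obtain ⟨n, -, b, hb⟩ := hx i ℓ
  obtain ⟨c, hc⟩ := covers_block hadm n (max n N) b
  refine ⟨((List.Ico N (max n N)).map a).prod.word c, hb.trans ?_⟩
  rw [← Subst.word_mul, ← iter_eq_mul a (le_max_right n N), iter_eq_mul a (le_max_left n N),
    Subst.word_mul]
  exact Subst.word_infix_onList hc

/-- The block of substitutions `ζ_{k+1} ∘ ⋯ ∘ ζ_n` maps each letter to a word with all letters. -/
def FullBlock (a : ℕ → Subst m) (k n : ℕ) : Prop :=
  ∀ b c, b ∈ ((List.Ico k n).map a).prod.word c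

theorem FullBlock.mono_left {a : ℕ → Subst m} (hadm : ∀ n, (a n).Admissible) {j k n : ℕ}
    (hjk : j ≤ k) (hkn : k ≤ n) (h : FullBlock a k n) : FullBlock a j n := by
  intro b c
  obtain ⟨d, hd⟩ := covers_block hadm j k b
  rw [← List.Ico.append_consecutive hjk hkn, List.map_append, List.prod_append, Subst.word_mul]
  exact List.mem_flatMap.2 ⟨d, h d c, hd⟩

theorem FullBlock.word_infix {a : ℕ → Subst m} {k n : ℕ} (hkn : k ≤ n) (h : FullBlock a k n)
    (b c : Fin m) : (iter a k).word b <:+: (iter a n).word c := by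
  rw [iter_eq_mul a hkn, Subst.word_mul]
  exact Subst.word_infix_onList (h b c)

theorem exists_fullBlock {a : ℕ → Subst m} (hadm : ∀ n, (a n).Admissible) (hA1 : CondA1' a)
    {ε : ℝ} (hε : 0 < ε) :
    ∃ n₀ : ℕ, ∀ n ≥ n₀, FullBlock a ⌊(n : ℝ) * (1 - ε)⌋₊ n := by
  obtain ⟨q, hq, h⟩ := hA1
  obtain ⟨n₀, hn₀⟩ := h ε hε
  refine ⟨n₀, fun n hn b c => ?_⟩
  obtain ⟨u, v, huv⟩ := hn₀ n hn
  have hcov (l : List (Subst m)) (hl : ∀ ζ ∈ l, ζ ∈ u ++ q ++ v) : l.prod.Covers :=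
    Subst.covers_prod fun ζ hζ => by
      have := hl ζ hζ
      rw [huv] at this
      obtain ⟨i, -, rfl⟩ := List.mem_map.1 this
      exact (hadm i).1
  obtain ⟨d, hd⟩ := hcov u (by simp +contextual) b
  obtain ⟨e, he⟩ := List.exists_mem_of_ne_nil _ (v.prod.ne_nil c)
  have hde : d ∈ q.prod.word e := Subst.matrix_pos_iff.1 (by rw [Subst.matrix_prod]; exact hq d e)
  rw [← huv, List.prod_append, List.prod_append, mul_assoc, Subst.word_mul, Subst.word_mul]
  exact List.mem_flatMap.2 ⟨d, List.mem_flatMap.2 ⟨e, he, hde⟩, hd⟩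

/-- If `ζ^{[N]}(c)` contains `ζ^{[n]}(b)` for all `c`, then long words of the language contain
`ζ^{[n]}(b)`. -/
theorem exists_occurrence {a : ℕ → Subst m} (hadm : ∀ n, (a n).Admissible) {x : ℤ → Fin m}
    (hx : x ∈ space a) {n N L : ℕ} (hnN : n ≤ N) (h : FullBlock a n N)
    (hL : ∀ c, ((iter a N).word c).length ≤ L) (b : Fin m) (i : ℤ) :
    ∃ j : ℕ, j < 2 * L ∧ factor x (i + j) ((iter a n).word b).length = (iter a n).word b := by
  have hL1 := ((iter a N).one_le_length_word b).trans (hL b)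
  obtain ⟨w, hw⟩ := exists_factor_infix hadm hx i (2 * L) N
  obtain ⟨c, hc⟩ := (iter a N).exists_word_infix_of_long hw hL (length_factor _ _ _).ge
    (by rw [← List.length_pos_iff, length_factor]; omega)
  obtain ⟨j, hj, hj'⟩ := exists_factor_eq_of_infix ((h.word_infix hnN b c).trans hc)
  have := (iter a n).one_le_length_word b
  exact ⟨j, by omega, hj'⟩

/-! ### Twisted sums over words -/

/-- `e(t) = exp(-2πi t)`. -/
noncomputable def e (t : ℝ) : ℂ := Complex.exp (-2 * Real.pi * Complex.I * (t : ℂ))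

theorem e_add (s t : ℝ) : e (s + t) = e s * e t := by
  rw [e, e, e, ← Complex.exp_add]; push_cast; ring_nf

theorem e_zero : e 0 = 1 := by simp [e]

theorem norm_e (t : ℝ) : ‖e t‖ = 1 := by
  rw [e, show (-2 * Real.pi * Complex.I * (t : ℂ)) = ((-2 * Real.pi * t : ℝ) : ℂ) * Complex.I by
    push_cast; ring]
  exact Complex.norm_exp_ofReal_mul_I _

theorem e_int (k : ℤ) : e k = 1 := by
  rw [e, Complex.exp_eq_one_iff]
  exact ⟨-k, by push_cast; ring⟩

theorem continuous_e : Continuous e := by unfold e; fun_prop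

/-- The twisted sum of a word `w`: `∑_j exp(-2πi (ξ_{w₁} + ⋯ + ξ_{w_{j-1}})) z_{w_j}`. -/
noncomputable def twistedSum (ξ : Fin m → ℝ) (z : Fin m → ℂ) : List (Fin m) → ℂ
  | [] => 0
  | c :: w => z c + e (ξ c) * twistedSum ξ z w

theorem twistedSum_append (ξ : Fin m → ℝ) (z : Fin m → ℂ) (v w : List (Fin m)) :
    twistedSum ξ z (v ++ w) = twistedSum ξ z v + e (v.map ξ).sum * twistedSum ξ z w := by
  induction v with
  | nil => simp [twistedSum, e_zero]
  | cons c v ih => simp [twistedSum, ih, e_add]; ring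

theorem norm_twistedSum_le (ξ : Fin m → ℝ) (z : Fin m → ℂ) (w : List (Fin m)) :
    ‖twistedSum ξ z w‖ ≤ w.length * ‖z‖ := by
  induction w with
  | nil => simp [twistedSum]
  | cons c w ih =>
    refine (norm_add_le _ _).trans ?_
    rw [norm_mul, norm_e, one_mul, List.length_cons]
    push_cast
    linarith [norm_le_pi_norm z c]

theorem twistedSum_eq_sum (ξ : Fin m → ℝ) (z : Fin m → ℂ) (w : List (Fin m)) :
    twistedSum ξ z w = ∑ j : Fin w.length, e ((w.take j).map ξ).sum * z (w.get j) := by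
  induction w with
  | nil => simp [twistedSum]
  | cons c w ih =>
    simp only [List.length_cons]
    rw [Fin.sum_univ_succ]
    simp [twistedSum, ih, e_zero, e_add, Finset.mul_sum, mul_assoc]

theorem cocycleMatrix_mulVec (ζ : Subst m) (ξ : Fin m → ℝ) (z : Fin m → ℂ) (b : Fin m) :
    (ζ.cocycleMatrix ξ).mulVec z b = twistedSum ξ z (ζ.word b) := by
  simp only [Matrix.mulVec, dotProduct, Subst.cocycleMatrix, Matrix.of_apply, Finset.sum_mul]
  rw [Finset.sum_comm, twistedSum_eq_sum]
  refine Finset.sum_congr rfl fun j _ => ?_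
  simp [e, ite_mul]

theorem transpose_matrix_mulVec (ζ : Subst m) (ξ : Fin m → ℝ) (b : Fin m) :
    ζ.matrix.transpose.mulVec ξ b = ((ζ.word b).map ξ).sum := by
  have h (w : List (Fin m)) : (w.map ξ).sum = ∑ i, (w.count i : ℝ) * ξ i := by
    induction w with
    | nil => simp
    | cons c w ih => simp [List.count_cons, add_mul, Finset.sum_add_distrib, ih, add_comm]
  simp [Matrix.mulVec, dotProduct, Subst.matrix, h]

theorem twistedSum_onList (ζ : Subst m) (ξ : Fin m → ℝ) (z : Fin m → ℂ) (w : List (Fin m)) :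
    twistedSum ξ z (ζ.onList w) =
      twistedSum (ζ.matrix.transpose.mulVec ξ) ((ζ.cocycleMatrix ξ).mulVec z) w := by
  induction w with
  | nil => rfl
  | cons c w ih =>
    rw [Subst.onList_cons, twistedSum_append, ih, twistedSum, cocycleMatrix_mulVec,
      transpose_matrix_mulVec]

theorem twistedSum_iter_onList (a : ℕ → Subst m) (ξ : Fin m → ℝ) (z : Fin m → ℂ) (n : ℕ)
    (w : List (Fin m)) :
    twistedSum ξ z ((iter a n).onList w) =
      twistedSum ((iter a n).matrix.transpose.mulVec ξ) ((cocycle a ξ n).mulVec z) w := by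
  induction n generalizing w with
  | zero =>
    have h : iter a 0 = 1 := rfl
    rw [h, Subst.onList_one, Subst.matrix_one, cocycle]
    simp
  | succ n ih =>
    rw [iter_succ, Subst.onList_mul, ih, twistedSum_onList, Subst.matrix_mul, cocycle,
      Matrix.transpose_mul, Matrix.mulVec_mulVec, Matrix.mulVec_mulVec]

theorem twistedSum_iter_word (a : ℕ → Subst m) (ξ : Fin m → ℝ) (z : Fin m → ℂ) (n : ℕ)
    (b : Fin m) : twistedSum ξ z ((iter a n).word b) = (cocycle a ξ n).mulVec z b := by
  rw [← Subst.onList_singleton, twistedSum_iter_onList]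
  simp [twistedSum]

/-- The bound for twisted sums over prefixes of the words `ζ^{[N]}(c)` that results from
decomposing them into images of letters of levels below `N`. -/
noncomputable def prefixBound (a : ℕ → Subst m) (ξ : Fin m → ℝ) (z : Fin m → ℂ) (N : ℕ) : ℝ :=
  ‖z‖ + ∑ n ∈ Finset.range N, norm1 (a n).matrix * ‖(cocycle a ξ n).mulVec z‖

theorem prefixBound_nonneg (a : ℕ → Subst m) (ξ : Fin m → ℝ) (z : Fin m → ℂ) (N : ℕ) :
    0 ≤ prefixBound a ξ z N :=
  add_nonneg (norm_nonneg _) (Finset.sum_nonneg fun _ _ =>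
    mul_nonneg (Subst.norm1_matrix_nonneg _) (norm_nonneg _))

theorem norm_twistedSum_prefix_onList {a : ℕ → Subst m} {ξ : Fin m → ℝ} {z : Fin m → ℂ} {N : ℕ}
    {B : ℝ} (hB0 : 0 ≤ B)
    (hB : ∀ p c, p <+: (iter a N).word c → ‖twistedSum ξ z p‖ ≤ B)
    {p w : List (Fin m)} (h : p <+: (iter a N).onList w) :
    ‖twistedSum ξ z p‖ ≤ w.length * ‖(cocycle a ξ N).mulVec z‖ + B := by
  obtain ⟨w', p', rfl, hw, hp⟩ := (iter a N).exists_of_prefix_onList h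
  rw [twistedSum_append, twistedSum_iter_onList]
  refine (norm_add_le _ _).trans (add_le_add ?_ ?_)
  · refine (norm_twistedSum_le _ _ _).trans ?_
    have : (w'.length : ℝ) ≤ w.length := by exact_mod_cast hw.length_le
    gcongr
  · rw [norm_mul, norm_e, one_mul]
    rcases hp with rfl | ⟨c, hc⟩
    · simpa [twistedSum] using hB0
    · exact hB _ c hc

theorem norm_twistedSum_prefix (a : ℕ → Subst m) (ξ : Fin m → ℝ) (z : Fin m → ℂ) (N : ℕ)
    {p : List (Fin m)} {c : Fin m} (h : p <+: (iter a N).word c) :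
    ‖twistedSum ξ z p‖ ≤ prefixBound a ξ z N := by
  induction N generalizing p c with
  | zero =>
    have h0 : iter a 0 = 1 := rfl
    rw [h0, Subst.word_one] at h
    refine (norm_twistedSum_le _ _ _).trans ?_
    have : (p.length : ℝ) ≤ 1 := by exact_mod_cast h.length_le
    simpa [prefixBound] using mul_le_mul_of_nonneg_right this (norm_nonneg z)
  | succ N ih =>
    rw [iter_succ, Subst.word_mul] at h
    refine (norm_twistedSum_prefix_onList (prefixBound_nonneg a ξ z N) (fun p c => ih) h).trans ?_
    have := (a N).length_word_le_norm1 c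
    rw [prefixBound, prefixBound, Finset.sum_range_succ]
    have := mul_le_mul_of_nonneg_right this (norm_nonneg ((cocycle a ξ N).mulVec z))
    linarith

/-- The twisted sum over a word of the language no longer than the words `ζ^{[N]}(c)` is controlled
by the cocycle up to level `N`. -/
theorem norm_twistedSum_factor_le {a : ℕ → Subst m} (hadm : ∀ n, (a n).Admissible)
    (ξ : Fin m → ℝ) (z : Fin m → ℂ) {x : ℤ → Fin m} (hx : x ∈ space a) (i : ℤ) {ℓ N : ℕ}
    (hN : ∀ c, ℓ ≤ ((iter a N).word c).length) :
    ‖twistedSum ξ z (factor x i ℓ)‖ ≤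
      2 * (2 * ‖(cocycle a ξ N).mulVec z‖ + prefixBound a ξ z N) := by
  obtain ⟨w, hw⟩ := exists_factor_infix hadm hx i ℓ N
  obtain ⟨w', hw', p, q, hpq⟩ := (iter a N).exists_infix_onList_pair hw
    (by simpa only [length_factor] using hN)
  have hpre (u : List (Fin m)) (hu : u <+: (iter a N).onList w') :
      ‖twistedSum ξ z u‖ ≤ 2 * ‖(cocycle a ξ N).mulVec z‖ + prefixBound a ξ z N := by
    refine (norm_twistedSum_prefix_onList (prefixBound_nonneg a ξ z N)
      (fun p c => norm_twistedSum_prefix a ξ z N) hu).trans ?_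
    have : (w'.length : ℝ) ≤ 2 := by exact_mod_cast hw'
    gcongr
  have h1 := hpre (p ++ factor x i ℓ) ⟨q, hpq⟩
  have h2 := hpre p ⟨factor x i ℓ ++ q, by rw [← hpq, List.append_assoc]⟩
  have h3 : ‖twistedSum ξ z (factor x i ℓ)‖ =
      ‖twistedSum ξ z (p ++ factor x i ℓ) - twistedSum ξ z p‖ := by
    rw [twistedSum_append, add_sub_cancel_left, norm_mul, norm_e, one_mul]
  rw [h3]
  linarith [norm_sub_le (twistedSum ξ z (p ++ factor x i ℓ)) (twistedSum ξ z p)]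

/-! ### Exponential growth rates -/

theorem exists_forall_le_mul_exp {ι : Type*} [Finite ι] {f : ℕ → ι → ℝ} {κ D : ℝ}
    (h : ∀ᶠ n in atTop, ∀ i, f n i ≤ D * Real.exp (κ * n)) :
    ∃ C > 0, ∀ n i, f n i ≤ C * Real.exp (κ * n) := by
  cases nonempty_fintype ι
  obtain ⟨n₀, hn₀⟩ := eventually_atTop.1 h
  have hS (n : ℕ) (i : ι) : 0 ≤ |f n i| * Real.exp (-(κ * n)) := by positivity
  set S := ∑ n ∈ Finset.range n₀, ∑ i, |f n i| * Real.exp (-(κ * n))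
  have hS0 : 0 ≤ S := Finset.sum_nonneg fun n _ => Finset.sum_nonneg fun i _ => hS n i
  refine ⟨|D| + S + 1, by positivity, fun n i => ?_⟩
  rcases le_or_gt n₀ n with hn | hn
  · refine (hn₀ n hn i).trans ?_
    gcongr
    linarith [le_abs_self D]
  · have h1 : |f n i| * Real.exp (-(κ * n)) ≤ S :=
      (Finset.single_le_sum (f := fun i => |f n i| * Real.exp (-(κ * n))) (fun i _ => hS n i)
        (Finset.mem_univ i)).trans
      (Finset.single_le_sum (f := fun n : ℕ => ∑ i, |f n i| * Real.exp (-(κ * n)))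
        (fun n _ => Finset.sum_nonneg fun i _ => hS n i) (Finset.mem_range.2 hn))
    have h2 : |f n i| * Real.exp (-(κ * n)) ≤ |D| + S + 1 := by linarith [abs_nonneg D]
    rw [Real.exp_neg, ← div_eq_mul_inv, div_le_iff₀ (Real.exp_pos _)] at h2
    exact (le_abs_self _).trans h2

theorem exists_forall_mul_exp_le {ι : Type*} [Finite ι] {f : ℕ → ι → ℝ} (hf : ∀ n i, 0 < f n i)
    {κ c : ℝ} (hc : 0 < c) (h : ∀ᶠ n : ℕ in atTop, ∀ i, c * Real.exp (κ * n) ≤ f n i) :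
    ∃ C > 0, ∀ (n : ℕ) i, C * Real.exp (κ * n) ≤ f n i := by
  obtain ⟨C, hC, hC'⟩ := exists_forall_le_mul_exp (f := fun n i => (f n i)⁻¹) (κ := -κ) (D := c⁻¹)
    (h.mono fun n hn i => by
      rw [neg_mul, Real.exp_neg, ← mul_inv]
      exact inv_anti₀ (by positivity) (hn i))
  refine ⟨C⁻¹, inv_pos.2 hC, fun n i => ?_⟩
  have := inv_anti₀ (inv_pos.2 (hf n i)) (hC' n i)
  rwa [neg_mul, Real.exp_neg, inv_inv, mul_inv, inv_inv] at this

theorem norm1_pos [Nonempty (Fin m)] (ζ : Subst m) : 0 < norm1 ζ.matrix := by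
  obtain ⟨j⟩ := ‹Nonempty (Fin m)›
  refine lt_of_lt_of_le ?_ (ζ.length_word_le_norm1 j)
  exact_mod_cast ζ.one_le_length_word j

theorem length_word_pos (ζ : Subst m) (b : Fin m) : (0 : ℝ) < (ζ.word b).length := by
  exact_mod_cast ζ.one_le_length_word b

theorem exists_length_le [Nonempty (Fin m)] {a : ℕ → Subst m} {lam : ℝ} (hA2 : CondA2 a lam)
    {δ : ℝ} (hδ : 0 < δ) :
    ∃ C > 0, ∀ n b, (((iter a n).word b).length : ℝ) ≤ C * Real.exp ((lam + δ) * n) := by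
  refine exists_forall_le_mul_exp (D := 1) ?_
  filter_upwards [hA2.eventually (gt_mem_nhds (show lam < lam + δ by linarith)),
    eventually_gt_atTop 0] with n hn hn0 b
  have hn0' : (0 : ℝ) < n := by exact_mod_cast hn0
  rw [one_div, inv_mul_lt_iff₀ hn0', mul_comm] at hn
  rw [one_mul]
  refine ((iter a n).length_word_le_norm1 b).trans ?_
  rw [← Real.log_le_iff_le_exp (norm1_pos _)]
  exact hn.le

theorem exists_le_norm1 [Nonempty (Fin m)] {a : ℕ → Subst m} {lam : ℝ} (hA2 : CondA2 a lam)
    {δ : ℝ} (hδ : 0 < δ) :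
    ∃ c > 0, ∀ n : ℕ, c * Real.exp ((lam - δ) * n) ≤ norm1 (iter a n).matrix := by
  obtain ⟨c, hc, h⟩ := exists_forall_mul_exp_le (ι := Unit)
    (f := fun n _ => norm1 (iter a n).matrix) (fun n _ => norm1_pos _) (κ := lam - δ) one_pos (by
      filter_upwards [hA2.eventually (lt_mem_nhds (show lam - δ < lam by linarith)),
        eventually_gt_atTop 0] with n hn hn0 _
      have hn0' : (0 : ℝ) < n := by exact_mod_cast hn0
      rw [one_div, lt_inv_mul_iff₀ hn0', mul_comm] at hn
      rw [one_mul, ← Real.le_log_iff_exp_le (norm1_pos _)]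
      exact hn.le)
  exact ⟨c, hc, fun n => h n ()⟩

/-- All the words `ζ^{[n]}(b)` grow at the rate `λ`, because `ζ^{[n]}(b)` contains all the
words `ζ^{[k]}(c)` for some `k` close to `n`. -/
theorem exists_le_length [Nonempty (Fin m)] {a : ℕ → Subst m} (hadm : ∀ n, (a n).Admissible)
    (hA1 : CondA1' a) {lam : ℝ} (hA2 : CondA2 a lam) {δ : ℝ} (hδ : 0 < δ) (hδ' : δ < lam) :
    ∃ c > 0, ∀ (n : ℕ) b, c * Real.exp ((lam - δ) * n) ≤ (((iter a n).word b).length : ℝ) := by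
  have hlam : 0 < lam := hδ.trans hδ'
  obtain ⟨c, hc, h⟩ := exists_le_norm1 hA2 (half_pos hδ)
  obtain ⟨n₀, hn₀⟩ := exists_fullBlock hadm hA1 (show 0 < δ / (2 * lam) by positivity)
  refine exists_forall_mul_exp_le (fun n b => length_word_pos _ _)
    (c := c * Real.exp (-(lam - δ / 2))) (by positivity) ?_
  filter_upwards [eventually_ge_atTop n₀] with n hn b
  have hε1 : δ / (2 * lam) ≤ 1 := by rw [div_le_one (by positivity)]; linarith
  set k := ⌊(n : ℝ) * (1 - δ / (2 * lam))⌋₊ with hk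
  have hkn : k ≤ n := by
    apply Nat.floor_le_of_le
    have : 0 ≤ δ / (2 * lam) := by positivity
    nlinarith [(Nat.cast_nonneg n : (0 : ℝ) ≤ n)]
  have hk1 : (n : ℝ) * (1 - δ / (2 * lam)) - 1 ≤ k := (Nat.sub_one_lt_floor _).le
  obtain ⟨j, hj⟩ := (iter a k).exists_length_word_eq_norm1
  have h1 : norm1 (iter a k).matrix ≤ ((iter a n).word b).length := by
    rw [← hj]
    exact_mod_cast ((hn₀ n hn).word_infix hkn j b).length_le
  refine le_trans ?_ ((h k).trans h1)
  rw [mul_assoc, ← Real.exp_add]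
  gcongr
  have h2 : (lam - δ / 2) * ((n : ℝ) * (1 - δ / (2 * lam)) - 1) ≤ (lam - δ / 2) * k := by
    apply mul_le_mul_of_nonneg_left hk1; linarith
  have h3 : (lam - δ / 2) * ((n : ℝ) * (1 - δ / (2 * lam)) - 1) =
      (lam - δ) * n + δ ^ 2 / (4 * lam) * n - (lam - δ / 2) := by field_simp; ring
  have h4 : 0 ≤ δ ^ 2 / (4 * lam) * n := by positivity
  linarith

theorem exists_norm1_le {a : ℕ → Subst m} (hA3 : CondA3 a) {δ : ℝ} (hδ : 0 < δ) :
    ∃ C > 0, ∀ n, norm1 (a n).matrix ≤ C * Real.exp (δ * n) := by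
  obtain ⟨c, hc, h⟩ := exists_forall_le_mul_exp (ι := Unit)
    (f := fun n _ => norm1 (a n).matrix) (κ := δ) (D := Real.exp δ) (by
      filter_upwards [hA3.eventually (gt_mem_nhds hδ)] with n hn _
      have h0 := (a n).norm1_matrix_nonneg
      have hn0' : (0 : ℝ) < n + 1 := by positivity
      rw [one_div, inv_mul_lt_iff₀ hn0', Real.log_lt_iff_lt_exp (by positivity)] at hn
      rw [← Real.exp_add]
      have : (n + 1 : ℝ) * δ = δ + δ * n := by ring
      rw [this] at hn
      linarith)
  exact ⟨c, hc, fun n => h n ()⟩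

theorem log_enorm_div_lt_iff {E : Type*} [SeminormedAddCommGroup E] (v : E) {n : ℕ} (hn : 0 < n)
    (κ : ℝ) :
    ENNReal.log ‖v‖ₑ / ((n : ℝ) : EReal) < κ ↔ ‖v‖ < Real.exp (κ * n) := by
  have hn0' : (0 : ℝ) < n := by exact_mod_cast hn
  rw [EReal.div_lt_iff (by exact_mod_cast hn0') (EReal.coe_ne_top _), ← EReal.coe_mul,
    ← Real.log_exp (κ * n), ← ENNReal.log_ofReal_of_pos (Real.exp_pos _),
    ENNReal.log_lt_log_iff, ← ofReal_norm, ENNReal.ofReal_lt_ofReal_iff (Real.exp_pos _),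
    Real.log_exp]

theorem lt_log_enorm_div_iff {E : Type*} [SeminormedAddCommGroup E] (v : E) {n : ℕ} (hn : 0 < n)
    (κ : ℝ) :
    (κ : EReal) < ENNReal.log ‖v‖ₑ / ((n : ℝ) : EReal) ↔ Real.exp (κ * n) < ‖v‖ := by
  have hn0' : (0 : ℝ) < n := by exact_mod_cast hn
  rw [EReal.lt_div_iff (by exact_mod_cast hn0') (EReal.coe_ne_top _), ← EReal.coe_mul,
    ← Real.log_exp (κ * n), ← ENNReal.log_ofReal_of_pos (Real.exp_pos _),
    ENNReal.log_lt_log_iff, ← ofReal_norm, ENNReal.ofReal_lt_ofReal_iff_of_nonneg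
      (Real.exp_pos _).le, Real.log_exp]

theorem exists_norm_cocycle_le {a : ℕ → Subst m} {ξ : Fin m → ℝ} {z : Fin m → ℂ} {κ : ℝ}
    (h : upperExponent a ξ z < κ) :
    ∃ C > 0, ∀ n, ‖(cocycle a ξ n).mulVec z‖ ≤ C * Real.exp (κ * n) := by
  obtain ⟨c, hc, h⟩ := exists_forall_le_mul_exp (ι := Unit)
    (f := fun n _ => ‖(cocycle a ξ n).mulVec z‖) (κ := κ) (D := 1) (by
      filter_upwards [Filter.eventually_lt_of_limsup_lt h, eventually_gt_atTop 0] with n hn hn0 _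
      rw [one_mul]
      exact ((log_enorm_div_lt_iff _ hn0 κ).1 hn).le)
  exact ⟨c, hc, fun n => h n ()⟩

theorem frequently_lt_norm_cocycle {a : ℕ → Subst m} {ξ : Fin m → ℝ} {z : Fin m → ℂ} {κ : ℝ}
    (h : (κ : EReal) < upperExponent a ξ z) :
    ∃ᶠ n : ℕ in atTop, Real.exp (κ * n) < ‖(cocycle a ξ n).mulVec z‖ := by
  refine ((Filter.frequently_lt_of_lt_limsup (by isBoundedDefault) h).and_eventually
    (eventually_gt_atTop 0)).mono fun n hn => ?_
  exact (lt_log_enorm_div_iff _ hn.2 κ).1 hn.1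

theorem norm_cocycle_le {a : ℕ → Subst m} (ξ : Fin m → ℝ) (z : Fin m → ℂ) (n : ℕ) :
    ‖(cocycle a ξ n).mulVec z‖ ≤ norm1 (iter a n).matrix * ‖z‖ := by
  refine (pi_norm_le_iff_of_nonneg (mul_nonneg (iter a n).norm1_matrix_nonneg
    (norm_nonneg z))).2 fun b => ?_
  rw [← twistedSum_iter_word]
  refine (norm_twistedSum_le _ _ _).trans ?_
  gcongr
  exact (iter a n).length_word_le_norm1 b

theorem upperExponent_le [Nonempty (Fin m)] {a : ℕ → Subst m} {lam : ℝ} (hA2 : CondA2 a lam)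
    (ξ : Fin m → ℝ) (z : Fin m → ℂ) : upperExponent a ξ z ≤ lam := by
  refine EReal.le_of_forall_lt_iff_le.1 fun κ hκ => ?_
  by_contra! hlt
  have hκ' : lam < κ := by exact_mod_cast hκ
  obtain ⟨C, hC, hle⟩ := exists_length_le hA2 (show 0 < (κ - lam) / 2 by linarith)
  have htend : Tendsto (fun n : ℕ => Real.exp ((κ - lam) / 2 * n)) atTop atTop :=
    Real.tendsto_exp_atTop.comp
      (tendsto_natCast_atTop_atTop.const_mul_atTop (by linarith))
  obtain ⟨n, hn, hn'⟩ := ((frequently_lt_norm_cocycle hlt).and_eventually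
    (htend.eventually_ge_atTop (C * ‖z‖))).exists
  refine absurd hn (not_lt.2 ((norm_cocycle_le ξ z n).trans ?_))
  obtain ⟨j, hj⟩ := (iter a n).exists_length_word_eq_norm1
  rw [← hj]
  calc _ ≤ C * Real.exp ((lam + (κ - lam) / 2) * n) * ‖z‖ := by gcongr; exact hle n j
    _ = (C * ‖z‖) * Real.exp ((lam + (κ - lam) / 2) * n) := by ring
    _ ≤ Real.exp ((κ - lam) / 2 * n) * Real.exp ((lam + (κ - lam) / 2) * n) := by gcongr
    _ = Real.exp (κ * n) := by rw [← Real.exp_add]; ring_nf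

theorem sum_exp_le {p : ℝ} (hp : 0 < p) (N : ℕ) :
    ∑ n ∈ Finset.range N, Real.exp (p * n) ≤ (Real.exp p - 1)⁻¹ * Real.exp (p * N) := by
  have h1 : 1 < Real.exp p := Real.one_lt_exp_iff.2 hp
  have h (n : ℕ) : Real.exp (p * n) = Real.exp p ^ n := by rw [mul_comm, Real.exp_nat_mul]
  simp_rw [h]
  rw [geom_sum_eq h1.ne', div_eq_inv_mul]
  have : 0 < Real.exp p - 1 := by linarith
  gcongr
  linarith

/-- Twisted sums over words of length `ℓ` of the language are `O((1 + ℓ)^{κ/λ})` as soon as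
`κ > 0` exceeds the exponent of the cocycle. -/
theorem exists_norm_twistedSum_factor_le [Nonempty (Fin m)] {a : ℕ → Subst m}
    (hadm : ∀ n, (a n).Admissible) (hA1 : CondA1' a) {lam : ℝ} (hA2 : CondA2 a lam)
    (hA3 : CondA3 a) (hlam : 0 < lam) {ξ : Fin m → ℝ} {z : Fin m → ℂ} {κ : ℝ} (hκ : 0 < κ)
    (h : upperExponent a ξ z < κ) :
    ∃ C > 0, ∀ x ∈ space a, ∀ i ℓ,
      ‖twistedSum ξ z (factor x i ℓ)‖ ≤ C * (1 + (ℓ : ℝ)) ^ (κ / lam) := by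
  obtain ⟨κ', hκ', hκκ'⟩ := EReal.lt_iff_exists_real_btwn.1
    (max_lt h (show ((0 : ℝ) : EReal) < κ by exact_mod_cast hκ))
  have hκ0 : 0 < κ' := by exact_mod_cast (le_max_right _ _).trans_lt hκ'
  have hκκ : κ' < κ := by exact_mod_cast hκκ'
  set δ := (κ - κ') * lam / (lam + κ) with hδdef
  have hδ : 0 < δ := by have : 0 < κ - κ' := by linarith
                        positivity
  have hδlam : δ < lam := by
    rw [hδdef, div_lt_iff₀ (by positivity)]; nlinarith
  have hδeq : δ * (lam + κ) = (κ - κ') * lam := by rw [hδdef]; field_simp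
  obtain ⟨C₁, hC₁, h₁⟩ := exists_norm1_le hA3 hδ
  obtain ⟨C₂, hC₂, h₂⟩ := exists_norm_cocycle_le ((le_max_left _ _).trans_lt hκ')
  obtain ⟨c, hc, h₃⟩ := exists_le_length hadm hA1 hA2 hδ hδlam
  set p := κ' + δ with hp
  set q := lam - δ with hq
  have hp0 : 0 < p := by positivity
  have hq0 : 0 < q := by linarith
  -- this choice of `δ` makes the loss in the exponent harmless
  have hpq : p / q = κ / lam := by
    rw [div_eq_div_iff hq0.ne' hlam.ne', hp, hq]; linarith
  have hexp : 1 < Real.exp p := Real.one_lt_exp_iff.2 hp0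
  have hexp' : 0 < Real.exp p - 1 := by linarith
  set C₃ := 2 * (2 * C₂ + (‖z‖ + C₁ * C₂ * (Real.exp p - 1)⁻¹)) with hC₃
  have hC₃0 : 0 < C₃ := by positivity
  have hbound (N : ℕ) : 2 * (2 * ‖(cocycle a ξ N).mulVec z‖ + prefixBound a ξ z N) ≤
      C₃ * Real.exp (p * N) := by
    have e1 : (1 : ℝ) ≤ Real.exp (p * N) := Real.one_le_exp (by positivity)
    have e2 : ‖(cocycle a ξ N).mulVec z‖ ≤ C₂ * Real.exp (p * N) := by
      refine (h₂ N).trans ?_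
      gcongr
      linarith
    have e3 : prefixBound a ξ z N ≤
        ‖z‖ * Real.exp (p * N) + C₁ * C₂ * ((Real.exp p - 1)⁻¹ * Real.exp (p * N)) := by
      refine add_le_add (le_mul_of_one_le_right (norm_nonneg _) e1) ?_
      refine le_trans ?_ (mul_le_mul_of_nonneg_left (sum_exp_le hp0 N) (by positivity))
      rw [Finset.mul_sum]
      refine Finset.sum_le_sum fun n _ => ?_
      refine (mul_le_mul (h₁ n) (h₂ n) (norm_nonneg _) (by positivity)).trans_eq ?_
      rw [hp, add_mul, Real.exp_add]; ring
    rw [hC₃]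
    linarith
  refine ⟨C₃ * (1 + Real.exp p * (1 / c) ^ (p / q)), by positivity, fun x hx i ℓ => ?_⟩
  have hℓ1 : (1 : ℝ) ≤ (1 + (ℓ : ℝ)) ^ (κ / lam) :=
    Real.one_le_rpow (by linarith [(Nat.cast_nonneg ℓ : (0 : ℝ) ≤ ℓ)]) (by positivity)
  have hex : ∃ N, ∀ c, ℓ ≤ ((iter a N).word c).length := by
    have htend : Tendsto (fun n : ℕ => c * Real.exp (q * n)) atTop atTop :=
      (Real.tendsto_exp_atTop.comp
        (tendsto_natCast_atTop_atTop.const_mul_atTop hq0)).const_mul_atTop hc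
    obtain ⟨N, hN⟩ := (htend.eventually_ge_atTop (ℓ : ℝ)).exists
    exact ⟨N, fun b => by exact_mod_cast hN.trans (h₃ N b)⟩
  classical
  have hmain := (norm_twistedSum_factor_le hadm ξ z hx i (Nat.find_spec hex)).trans (hbound _)
  refine hmain.trans ?_
  rw [mul_assoc C₃]
  refine mul_le_mul_of_nonneg_left ?_ hC₃0.le
  rw [add_mul (1 : ℝ), one_mul]
  rcases hN : Nat.find hex with _ | N
  · simp only [Nat.cast_zero, mul_zero, Real.exp_zero]
    have : 0 ≤ Real.exp p * (1 / c) ^ (p / q) * (1 + (ℓ : ℝ)) ^ (κ / lam) := by positivity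
    linarith
  · have hmin := Nat.find_min hex (m := N) (by omega)
    push Not at hmin
    obtain ⟨b, hb⟩ := hmin
    have h4 : c * Real.exp (q * N) ≤ 1 + (ℓ : ℝ) := by
      have : (((iter a N).word b).length : ℝ) ≤ ℓ := by exact_mod_cast hb.le
      linarith [h₃ N b]
    have h5 : Real.exp (q * N) ≤ 1 / c * (1 + (ℓ : ℝ)) := by
      rw [one_div, ← div_eq_inv_mul, le_div_iff₀ hc]; linarith
    have h6 := Real.rpow_le_rpow (Real.exp_pos _).le h5 (show 0 ≤ p / q by positivity)
    rw [← Real.exp_mul, Real.mul_rpow (by positivity) (by positivity)] at h6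
    have h7 : q * N * (p / q) = p * N := by field_simp
    rw [h7] at h6
    have h8 : Real.exp (p * (N + 1 : ℕ)) = Real.exp p * Real.exp (p * N) := by
      rw [← Real.exp_add]; push_cast; ring_nf
    rw [h8, mul_assoc, ← hpq]
    have := mul_le_mul_of_nonneg_left h6 (Real.exp_pos p).le
    have h9 : 0 ≤ (1 + (ℓ : ℝ)) ^ (p / q) := by positivity
    linarith

/-! ### The observable along the orbits of the suspension flow -/

theorem floorIndex_spec {s : Fin m → ℝ} (hs : ∀ j, 0 < s j) (x : ℤ → Fin m) (u : ℝ) :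
    roofSum s x (floorIndex s x u) ≤ u ∧ u < roofSum s x (floorIndex s x u + 1) :=
  Classical.epsilon_spec (existsUnique_floor s hs x u).exists

theorem floorIndex_eq_iff {s : Fin m → ℝ} (hs : ∀ j, 0 < s j) {x : ℤ → Fin m} {u : ℝ} {n : ℤ} :
    floorIndex s x u = n ↔ roofSum s x n ≤ u ∧ u < roofSum s x (n + 1) := by
  constructor
  · rintro rfl
    exact floorIndex_spec hs x u
  · exact fun h => (existsUnique_floor s hs x u).unique (floorIndex_spec hs x u) h

theorem roofSum_zero (s : Fin m → ℝ) (x : ℤ → Fin m) : roofSum s x 0 = 0 := by simp [roofSum]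

theorem roofSum_shift (s : Fin m → ℝ) (x : ℤ → Fin m) (n : ℤ) :
    roofSum s (shift x) n = roofSum s x (n + 1) - s (x 0) := by
  induction n using Int.induction_on with
  | zero => rw [roofSum_succ, roofSum_zero, roofSum_zero]; ring
  | succ n ih => rw [roofSum_succ, ih, roofSum_succ s x (n + 1), shift]; ring
  | pred n ih =>
    have h1 := roofSum_succ s (shift x) (-(n : ℤ) - 1)
    have h2 := roofSum_succ s x (-(n : ℤ))
    simp only [sub_add_cancel] at h1 ⊢
    rw [ih, h2] at h1
    simp only [shift, sub_add_cancel] at h1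
    linarith

theorem strictMono_roofSum {s : Fin m → ℝ} (hs : ∀ j, 0 < s j) (x : ℤ → Fin m) :
    StrictMono (roofSum s x) :=
  strictMono_int_of_lt_succ fun n => by rw [roofSum_succ]; linarith [hs (x n)]

theorem roofSum_add (s : Fin m → ℝ) (x : ℤ → Fin m) (i : ℤ) (ℓ : ℕ) :
    roofSum s x (i + ℓ) = roofSum s x i + ((factor x i ℓ).map s).sum := by
  induction ℓ with
  | zero => simp [factor]
  | succ ℓ ih => rw [Nat.cast_succ, ← add_assoc, roofSum_succ, ih, factor_succ]; simp; ring

theorem sum_map_le {s : Fin m → ℝ} {M : ℝ} (hM : ∀ j, s j ≤ M) (w : List (Fin m)) :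
    (w.map s).sum ≤ w.length * M := by
  simpa using List.sum_le_card_nsmul (w.map s) M (by simpa using fun j _ => hM j)

theorem le_sum_map {s : Fin m → ℝ} {c : ℝ} (hc : ∀ j, c ≤ s j) (w : List (Fin m)) :
    w.length * c ≤ (w.map s).sum := by
  simpa using List.card_nsmul_le_sum (w.map s) c (by simpa using fun j _ => hc j)

theorem measurable_roofSum (s : Fin m → ℝ) (n : ℤ) :
    Measurable fun x : ℤ → Fin m => roofSum s x n := by
  unfold roofSum
  have h (i : ℤ) : Measurable fun x : ℤ → Fin m => s (x i) :=
    (measurable_of_countable s).comp (measurable_pi_apply i)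
  exact (Finset.measurable_sum _ fun i _ => h i).sub (Finset.measurable_sum _ fun i _ => h i)

theorem measurable_floorIndex {s : Fin m → ℝ} (hs : ∀ j, 0 < s j) :
    Measurable fun p : (ℤ → Fin m) × ℝ => floorIndex s p.1 p.2 := by
  refine measurable_to_countable' fun n => ?_
  have : (fun p : (ℤ → Fin m) × ℝ => floorIndex s p.1 p.2) ⁻¹' {n} =
      {p | roofSum s p.1 n ≤ p.2} ∩ {p | p.2 < roofSum s p.1 (n + 1)} := by
    ext p
    simp [floorIndex_eq_iff hs]
  rw [this]
  exact (measurableSet_le ((measurable_roofSum s n).comp measurable_fst) measurable_snd).inter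
    (measurableSet_lt measurable_snd ((measurable_roofSum s (n + 1)).comp measurable_fst))

/-- The cylindrical function along the orbit of `(x, 0)`: the value at time `u` is
`ψ_j(u - roofSum s x n)`, where `n` is the floor reached at time `u` and `j = x n`. Only the
restrictions of the `ψ_j` to `[0, s_j]` enter. -/
noncomputable def orbitFun (s : Fin m → ℝ) (ψ : Fin m → ℝ → ℂ) (x : ℤ → Fin m) (u : ℝ) : ℂ :=
  (Set.Icc 0 (s (x (floorIndex s x u)))).indicator (ψ (x (floorIndex s x u)))
    (u - roofSum s x (floorIndex s x u))

theorem orbitFun_eq {s : Fin m → ℝ} (hs : ∀ j, 0 < s j) (ψ : Fin m → ℝ → ℂ) {x : ℤ → Fin m}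
    {u : ℝ} {n : ℤ} (h : roofSum s x n ≤ u) (h' : u < roofSum s x (n + 1)) :
    orbitFun s ψ x u = ψ (x n) (u - roofSum s x n) := by
  have hn : floorIndex s x u = n := (floorIndex_eq_iff hs).2 (And.intro h h')
  rw [orbitFun, hn]
  rw [roofSum_succ] at h'
  have hmem : u - roofSum s x n ∈ Set.Icc 0 (s (x n)) := ⟨by linarith, by linarith⟩
  exact Set.indicator_of_mem hmem _

theorem cylindrical_flow {s : Fin m → ℝ} (hs : ∀ j, 0 < s j) (ψ : Fin m → ℝ → ℂ) (τ : ℝ)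
    (p : (ℤ → Fin m) × ℝ) : cylindrical ψ (flow s τ p) = orbitFun s ψ p.1 (p.2 + τ) := by
  obtain ⟨h, h'⟩ := floorIndex_spec hs p.1 (p.2 + τ)
  rw [orbitFun_eq hs ψ h h']
  simp [cylindrical, flow]

theorem cylindrical_eq_orbitFun {s : Fin m → ℝ} (hs : ∀ j, 0 < s j) (ψ : Fin m → ℝ → ℂ)
    {p : (ℤ → Fin m) × ℝ} (hp : p ∈ suspension s) : cylindrical ψ p = orbitFun s ψ p.1 p.2 := by
  rw [orbitFun_eq hs ψ (n := 0) (by rw [roofSum_zero]; exact hp.1)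
    (by rw [roofSum_succ, roofSum_zero, zero_add]; exact hp.2)]
  simp [cylindrical, roofSum_zero]

theorem orbitFun_shift {s : Fin m → ℝ} (hs : ∀ j, 0 < s j) (ψ : Fin m → ℝ → ℂ) (x : ℤ → Fin m)
    (u : ℝ) : orbitFun s ψ (shift x) u = orbitFun s ψ x (u + s (x 0)) := by
  obtain ⟨h, h'⟩ := floorIndex_spec hs (shift x) u
  have e1 := roofSum_shift s x (floorIndex s (shift x) u)
  have e2 := roofSum_shift s x (floorIndex s (shift x) u + 1)
  rw [orbitFun_eq hs ψ h h',
    orbitFun_eq hs ψ (n := floorIndex s (shift x) u + 1) (by linarith) (by linarith), e1, shift]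
  ring_nf

theorem measurable_orbitFun {s : Fin m → ℝ} (hs : ∀ j, 0 < s j) {ψ : Fin m → ℝ → ℂ}
    (hψ : ∀ j, ContinuousOn (ψ j) (Set.Icc 0 (s j))) :
    Measurable fun p : (ℤ → Fin m) × ℝ => orbitFun s ψ p.1 p.2 := by
  have h1 (j : Fin m) : Measurable ((Set.Icc 0 (s j)).indicator (ψ j)) := by
    classical
    rw [← Set.piecewise_eq_indicator]
    exact (hψ j).measurable_piecewise continuousOn_const measurableSet_Icc
  have h2 : Measurable fun q : (ℤ × Fin m) × ((ℤ → Fin m) × ℝ) =>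
      (Set.Icc 0 (s q.1.2)).indicator (ψ q.1.2) (q.2.2 - roofSum s q.2.1 q.1.1) :=
    measurable_from_prod_countable_right fun q =>
      (h1 q.2).comp (measurable_snd.sub ((measurable_roofSum s q.1).comp measurable_fst))
  have h3 : Measurable fun q : ℤ × (ℤ → Fin m) => q.2 q.1 :=
    measurable_from_prod_countable_right fun n => measurable_pi_apply n
  have hf := measurable_floorIndex hs
  exact h2.comp ((hf.prodMk (h3.comp (hf.prodMk measurable_fst))).prodMk measurable_id)

theorem exists_norm_orbitFun_le (s : Fin m → ℝ) {ψ : Fin m → ℝ → ℂ}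
    (hψ : ∀ j, ContinuousOn (ψ j) (Set.Icc 0 (s j))) :
    ∃ K > 0, ∀ x u, ‖orbitFun s ψ x u‖ ≤ K := by
  choose K hK using fun j => isCompact_Icc.exists_bound_of_continuousOn (hψ j)
  refine ⟨1 + ∑ j, |K j|, by positivity, fun x u => ?_⟩
  have hj (j : Fin m) : |K j| ≤ 1 + ∑ j, |K j| := by
    linarith [Finset.single_le_sum (f := fun j => |K j|) (fun i _ => abs_nonneg _)
      (Finset.mem_univ j)]
  unfold orbitFun
  set j := x (floorIndex s x u)
  by_cases h : u - roofSum s x (floorIndex s x u) ∈ Set.Icc 0 (s j)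
  · rw [Set.indicator_of_mem h]
    exact (hK j _ h).trans ((le_abs_self _).trans (hj j))
  · rw [Set.indicator_of_notMem h, norm_zero]
    exact (abs_nonneg _).trans (hj j)

theorem intervalIntegrable_orbitFun {s : Fin m → ℝ} (hs : ∀ j, 0 < s j) {ψ : Fin m → ℝ → ℂ}
    (hψ : ∀ j, ContinuousOn (ψ j) (Set.Icc 0 (s j))) (ω : ℝ) (x : ℤ → Fin m) (c d : ℝ) :
    IntervalIntegrable (fun u => e (ω * u) * orbitFun s ψ x u) volume c d := by
  obtain ⟨K, -, hK⟩ := exists_norm_orbitFun_le s hψ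
  have hm : Measurable fun u => e (ω * u) * orbitFun s ψ x u :=
    (continuous_e.measurable.comp (measurable_const.mul measurable_id)).mul
      ((measurable_orbitFun hs hψ).comp measurable_prodMk_left)
  refine (intervalIntegrable_const (c := K)).mono_fun hm.aestronglyMeasurable
    (Eventually.of_forall fun u => ?_)
  change ‖e (ω * u) * orbitFun s ψ x u‖ ≤ ‖K‖
  rw [norm_mul, norm_e, one_mul]
  exact (hK x u).trans (le_abs_self K)

theorem norm_integral_orbitFun_le {s : Fin m → ℝ} {ψ : Fin m → ℝ → ℂ} {K : ℝ}
    (hK : ∀ x u, ‖orbitFun s ψ x u‖ ≤ K) (ω : ℝ) (x : ℤ → Fin m) (c d : ℝ) :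
    ‖∫ u in c..d, e (ω * u) * orbitFun s ψ x u‖ ≤ K * |d - c| :=
  intervalIntegral.norm_integral_le_of_norm_le_const fun u _ => by
    rw [norm_mul, norm_e, one_mul]; exact hK x u

theorem integral_orbitFun_floor {s : Fin m → ℝ} (hs : ∀ j, 0 < s j) (ψ : Fin m → ℝ → ℂ) (ω : ℝ)
    (x : ℤ → Fin m) (n : ℤ) :
    ∫ u in roofSum s x n..roofSum s x (n + 1), e (ω * u) * orbitFun s ψ x u =
      e (ω * roofSum s x n) * fourierOn (s (x n)) (ψ (x n)) ω := by
  have hlt := (strictMono_roofSum hs x (lt_add_one n)).le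
  have h1 : ∫ u in roofSum s x n..roofSum s x (n + 1), e (ω * u) * orbitFun s ψ x u =
      ∫ u in roofSum s x n..roofSum s x (n + 1), e (ω * u) * ψ (x n) (u - roofSum s x n) := by
    rw [intervalIntegral.integral_of_le hlt, intervalIntegral.integral_of_le hlt,
      ← integral_Ico_eq_integral_Ioc, ← integral_Ico_eq_integral_Ioc]
    refine setIntegral_congr_fun measurableSet_Ico fun u hu => ?_
    simp only [orbitFun_eq hs ψ hu.1 hu.2]
  have h2 := intervalIntegral.integral_comp_sub_right (a := roofSum s x n)
    (b := roofSum s x (n + 1)) (fun t => e (ω * (t + roofSum s x n)) * ψ (x n) t) (roofSum s x n)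
  simp only [sub_add_cancel, sub_self] at h2
  rw [h1, h2, roofSum_succ, add_sub_cancel_left, fourierOn, ← intervalIntegral.integral_const_mul]
  congr 1
  ext t
  rw [mul_add, e_add, e, e]
  push_cast
  ring_nf

theorem e_eq_of_congr {s ξ : Fin m → ℝ} {ω : ℝ} (hξ : ∀ j, ∃ k : ℤ, ξ j = ω * s j + k)
    (j : Fin m) : e (ξ j) = e (ω * s j) := by
  obtain ⟨k, hk⟩ := hξ j
  rw [hk, e_add, e_int, mul_one]

theorem e_sum_map {s ξ : Fin m → ℝ} {ω : ℝ} (hξ : ∀ j, ∃ k : ℤ, ξ j = ω * s j + k)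
    (w : List (Fin m)) : e (w.map ξ).sum = e (ω * (w.map s).sum) := by
  induction w with
  | nil => simp
  | cons c w ih => simp only [List.map_cons, List.sum_cons, e_add, mul_add, ih, e_eq_of_congr hξ]

/-- Over a union of whole floors the twisted integral is a twisted sum of the word read off the
floors. -/
theorem integral_orbitFun_factor {s : Fin m → ℝ} (hs : ∀ j, 0 < s j) {ψ : Fin m → ℝ → ℂ}
    (hψ : ∀ j, ContinuousOn (ψ j) (Set.Icc 0 (s j))) {ω : ℝ} {ξ : Fin m → ℝ} {z : Fin m → ℂ}
    (hξ : ∀ j, ∃ k : ℤ, ξ j = ω * s j + k) (hz : ∀ j, z j = fourierOn (s j) (ψ j) ω)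
    (x : ℤ → Fin m) (i : ℤ) (ℓ : ℕ) :
    ∫ u in roofSum s x i..roofSum s x (i + ℓ), e (ω * u) * orbitFun s ψ x u =
      e (ω * roofSum s x i) * twistedSum ξ z (factor x i ℓ) := by
  induction ℓ with
  | zero => simp [factor, twistedSum]
  | succ ℓ ih =>
    rw [Nat.cast_succ, ← add_assoc, ← intervalIntegral.integral_add_adjacent_intervals
      (intervalIntegrable_orbitFun hs hψ ω x _ (roofSum s x (i + ℓ)))
      (intervalIntegrable_orbitFun hs hψ ω x _ _), ih, integral_orbitFun_floor hs, factor_succ,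
      twistedSum_append, e_sum_map hξ, roofSum_add, mul_add, mul_add, e_add, ← hz]
    simp [twistedSum, mul_assoc]

theorem exists_roof_bounds [Nonempty (Fin m)] {s : Fin m → ℝ} (hs : ∀ j, 0 < s j) :
    ∃ c M : ℝ, 0 < c ∧ 0 < M ∧ (∀ j, c ≤ s j) ∧ ∀ j, s j ≤ M := by
  obtain ⟨i, hi⟩ := Finite.exists_min s
  obtain ⟨j, hj⟩ := Finite.exists_max s
  exact ⟨s i, s j, hs i, hs j, hi, hj⟩

/-- A power bound for twisted sums over words gives the same power bound for twisted integrals over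
all intervals. -/
theorem exists_norm_integral_le [Nonempty (Fin m)] {s : Fin m → ℝ} (hs : ∀ j, 0 < s j)
    {ψ : Fin m → ℝ → ℂ} (hψ : ∀ j, ContinuousOn (ψ j) (Set.Icc 0 (s j))) {ω : ℝ}
    {ξ : Fin m → ℝ} {z : Fin m → ℂ} (hξ : ∀ j, ∃ k : ℤ, ξ j = ω * s j + k)
    (hz : ∀ j, z j = fourierOn (s j) (ψ j) ω) {X : Set (ℤ → Fin m)} {C β : ℝ} (hC : 0 < C)
    (hβ : 0 < β)
    (hT : ∀ x ∈ X, ∀ i ℓ, ‖twistedSum ξ z (factor x i ℓ)‖ ≤ C * (1 + (ℓ : ℝ)) ^ β) :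
    ∃ C' > 0, ∀ x ∈ X, ∀ t R : ℝ, 0 ≤ R →
      ‖∫ u in t..t + R, e (ω * u) * orbitFun s ψ x u‖ ≤ C' * (1 + R) ^ β := by
  obtain ⟨K, hK0, hK⟩ := exists_norm_orbitFun_le s hψ
  obtain ⟨c, M, hc, hM, hcs, hsM⟩ := exists_roof_bounds hs
  set D := 1 + (1 + M) / c with hD
  have hD0 : 0 < D := by positivity
  refine ⟨C * D ^ β + 2 * (K * M), by positivity, fun x hx t R hR => ?_⟩
  obtain ⟨h1, h2⟩ := floorIndex_spec hs x t
  obtain ⟨h3, h4⟩ := floorIndex_spec hs x (t + R)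
  have hle : floorIndex s x t ≤ floorIndex s x (t + R) := by
    have := (strictMono_roofSum hs x).lt_iff_lt.1 ((h1.trans (by linarith)).trans_lt h4)
    omega
  obtain ⟨ℓ, hℓ⟩ := Int.le.dest hle
  set i := floorIndex s x t
  rw [← hℓ] at h3 h4
  rw [roofSum_succ] at h2 h4
  have hlen := le_sum_map hcs (factor x i ℓ)
  rw [length_factor] at hlen
  have hroof := roofSum_add s x i ℓ
  have hℓR : 1 + (ℓ : ℝ) ≤ D * (1 + R) := by
    have h5 : (ℓ : ℝ) * c ≤ R + M := by linarith [hsM (x i)]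
    rw [← le_div_iff₀ hc] at h5
    have h6 : (R + M) / c ≤ (1 + M) / c * (1 + R) := by
      rw [div_mul_eq_mul_div]
      gcongr
      nlinarith
    rw [hD, add_mul]
    linarith
  have hI := intervalIntegrable_orbitFun hs hψ ω x
  have hsplit : ∫ u in t..t + R, e (ω * u) * orbitFun s ψ x u =
      (∫ u in t..roofSum s x i, e (ω * u) * orbitFun s ψ x u) +
      (∫ u in roofSum s x i..roofSum s x (i + ℓ), e (ω * u) * orbitFun s ψ x u) +
      ∫ u in roofSum s x (i + ℓ)..t + R, e (ω * u) * orbitFun s ψ x u := by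
    rw [intervalIntegral.integral_add_adjacent_intervals (hI _ _) (hI _ _),
      intervalIntegral.integral_add_adjacent_intervals (hI _ _) (hI _ _)]
  have hA := norm_integral_orbitFun_le hK ω x t (roofSum s x i)
  have hB := norm_integral_orbitFun_le hK ω x (roofSum s x (i + ℓ)) (t + R)
  have hA' : |roofSum s x i - t| ≤ M := abs_le.2 ⟨by linarith [hsM (x i)], by linarith⟩
  have hB' : |t + R - roofSum s x (i + ℓ)| ≤ M :=
    abs_le.2 ⟨by linarith, by linarith [hsM (x (i + ℓ))]⟩
  have hone : 1 ≤ (1 + R) ^ β := Real.one_le_rpow (by linarith) hβ.le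
  rw [hsplit]
  refine (norm_add₃_le).trans ?_
  rw [integral_orbitFun_factor hs hψ hξ hz, norm_mul, norm_e, one_mul]
  have hT1 : ‖twistedSum ξ z (factor x i ℓ)‖ ≤ C * D ^ β * (1 + R) ^ β := by
    refine (hT x hx i ℓ).trans ?_
    rw [mul_assoc, ← Real.mul_rpow hD0.le (by linarith)]
    gcongr
  have hA2 := hA.trans (mul_le_mul_of_nonneg_left hA' hK0.le)
  have hB2 := hB.trans (mul_le_mul_of_nonneg_left hB' hK0.le)
  have hKM : 2 * (K * M) ≤ 2 * (K * M) * (1 + R) ^ β := le_mul_of_one_le_right (by positivity) hone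
  rw [add_mul]
  linarith

/-! ### Integration over the suspension and invariance under the flow -/

theorem integrable_of_bound {Y E : Type*} [MeasurableSpace Y] [NormedAddCommGroup E]
    {ν : Measure Y} [IsFiniteMeasure ν] {g : Y → E} (hg : AEStronglyMeasurable g ν) {K : ℝ}
    (hK : ∀ y, ‖g y‖ ≤ K) : Integrable g ν :=
  Integrable.of_bound hg K (Eventually.of_forall hK)

theorem measurableSet_suspension (s : Fin m → ℝ) : MeasurableSet (suspension s) := by
  have h : Measurable fun p : (ℤ → Fin m) × ℝ => s (p.1 0) :=
    (measurable_of_countable s).comp ((measurable_pi_apply 0).comp measurable_fst)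
  exact (measurableSet_le measurable_const measurable_snd).inter (measurableSet_lt measurable_snd h)

theorem suspension_subset {s : Fin m → ℝ} {M : ℝ} (hM : ∀ j, s j ≤ M) :
    suspension s ⊆ Set.univ ×ˢ Set.Ico 0 M := fun _ hp =>
  ⟨trivial, hp.1, hp.2.trans_le (hM _)⟩

theorem prod_suspension_lt_top [Nonempty (Fin m)] {s : Fin m → ℝ} (hs : ∀ j, 0 < s j)
    (μ : Measure (ℤ → Fin m)) [IsFiniteMeasure μ] : (μ.prod volume) (suspension s) < ∞ := by
  obtain ⟨c, M, -, -, -, hM⟩ := exists_roof_bounds hs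
  refine (measure_mono (suspension_subset hM)).trans_lt ?_
  rw [Measure.prod_prod]
  exact ENNReal.mul_lt_top (measure_lt_top _ _) (by simp)

theorem le_prod_suspension [Nonempty (Fin m)] {s : Fin m → ℝ} {c : ℝ} (hc : ∀ j, c ≤ s j)
    (μ : Measure (ℤ → Fin m)) [IsFiniteMeasure μ] {D : Set (ℤ → Fin m)} :
    μ D * ENNReal.ofReal c ≤ (μ.prod volume) (Prod.fst ⁻¹' D ∩ suspension s) := by
  have : D ×ˢ Set.Ico 0 c ⊆ Prod.fst ⁻¹' D ∩ suspension s := fun p hp =>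
    ⟨hp.1, hp.2.1, hp.2.2.trans_le (hc _)⟩
  refine le_trans ?_ (measure_mono this)
  rw [Measure.prod_prod]
  simp

theorem prod_suspension_pos [Nonempty (Fin m)] {s : Fin m → ℝ} (hs : ∀ j, 0 < s j)
    (μ : Measure (ℤ → Fin m)) [IsProbabilityMeasure μ] : 0 < (μ.prod volume) (suspension s) := by
  obtain ⟨c, M, hc, -, hcs, -⟩ := exists_roof_bounds hs
  have := le_prod_suspension hcs μ (D := Set.univ)
  simp only [measure_univ, one_mul, Set.preimage_univ, Set.univ_inter] at this
  exact (ENNReal.ofReal_pos.2 hc).trans_le this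

theorem isProbabilityMeasure_suspMeasure [Nonempty (Fin m)] {s : Fin m → ℝ} (hs : ∀ j, 0 < s j)
    (μ : Measure (ℤ → Fin m)) [IsProbabilityMeasure μ] :
    IsProbabilityMeasure (suspMeasure s μ) := by
  constructor
  rw [suspMeasure, Measure.smul_apply, Measure.restrict_apply_univ, smul_eq_mul]
  exact ENNReal.inv_mul_cancel (prod_suspension_pos hs μ).ne' (prod_suspension_lt_top hs μ).ne

theorem ae_mem_suspension (s : Fin m → ℝ) (μ : Measure (ℤ → Fin m)) :
    ∀ᵐ p ∂suspMeasure s μ, p ∈ suspension s :=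
  Measure.ae_smul_measure (ae_restrict_mem (measurableSet_suspension s)) _

theorem ae_fst_suspMeasure (s : Fin m → ℝ) {μ : Measure (ℤ → Fin m)} [IsFiniteMeasure μ]
    {P : (ℤ → Fin m) → Prop} (h : ∀ᵐ x ∂μ, P x) : ∀ᵐ p ∂suspMeasure s μ, P p.1 :=
  Measure.ae_smul_measure (ae_restrict_of_ae (Measure.quasiMeasurePreserving_fst.ae h)) _

theorem integral_suspMeasure [Nonempty (Fin m)] {s : Fin m → ℝ} (hs : ∀ j, 0 < s j)
    (μ : Measure (ℤ → Fin m)) [IsProbabilityMeasure μ] {G : (ℤ → Fin m) × ℝ → ℂ}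
    (hG : Measurable G) {K : ℝ} (hK : ∀ p, ‖G p‖ ≤ K) :
    ∫ p, G p ∂suspMeasure s μ =
      (((μ.prod volume) (suspension s))⁻¹).toReal • ∫ x, (∫ u in (0 : ℝ)..s (x 0), G (x, u)) ∂μ := by
  rw [suspMeasure, integral_smul_measure, ← integral_indicator (measurableSet_suspension s)]
  congr 1
  have hfin : IsFiniteMeasure ((μ.prod volume).restrict (suspension s)) :=
    ⟨by rw [Measure.restrict_apply_univ]; exact prod_suspension_lt_top hs μ⟩
  rw [integral_prod _ ((integrable_indicator_iff (measurableSet_suspension s)).2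
    (integrable_of_bound hG.aestronglyMeasurable hK))]
  congr 1
  ext x
  rw [intervalIntegral.integral_of_le (hs _).le, ← integral_Ico_eq_integral_Ioc,
    ← integral_indicator measurableSet_Ico]
  rfl

/-- The integral over the suspension of a function that is given along orbits does not change when
the time parameter is shifted: this is the invariance of the measure under the flow. -/
theorem integral_time_shift {s : Fin m → ℝ} {μ : Measure (ℤ → Fin m)} [IsProbabilityMeasure μ]
    [Nonempty (Fin m)] (hs : ∀ j, 0 < s j)
    (hμ : MeasurePreserving shift μ μ) {g : (ℤ → Fin m) → ℝ → ℂ}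
    (hg : Measurable fun p : (ℤ → Fin m) × ℝ => g p.1 p.2) {K : ℝ} (hK : ∀ x u, ‖g x u‖ ≤ K)
    (hshift : ∀ x u, g (shift x) u = g x (u + s (x 0))) (t : ℝ) :
    ∫ p, g p.1 (p.2 + t) ∂suspMeasure s μ = ∫ p, g p.1 p.2 ∂suspMeasure s μ := by
  have hg' (x : ℤ → Fin m) : Measurable (g x) := hg.comp measurable_prodMk_left
  have hI (x : ℤ → Fin m) (c d : ℝ) : IntervalIntegrable (g x) volume c d :=
    (intervalIntegrable_const (c := K)).mono_fun (hg' x).aestronglyMeasurable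
      (Eventually.of_forall fun u => (hK x u).trans (le_abs_self K))
  set P : (ℤ → Fin m) → ℂ := fun x => ∫ u in (0 : ℝ)..t, g x u with hP
  have hPm : StronglyMeasurable P := by
    simp only [hP, intervalIntegral]
    exact (StronglyMeasurable.integral_prod_right (f := g) hg.stronglyMeasurable).sub
      (StronglyMeasurable.integral_prod_right (f := g) hg.stronglyMeasurable)
  have hPb (x : ℤ → Fin m) : ‖P x‖ ≤ K * |t - 0| :=
    intervalIntegral.norm_integral_le_of_norm_le_const fun u _ => hK x u
  have hPi : Integrable P μ := integrable_of_bound hPm.aestronglyMeasurable hPb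
  have hPsi : Integrable (fun x => P (shift x)) μ :=
    integrable_of_bound (hPm.comp_measurable hμ.measurable).aestronglyMeasurable fun x => hPb _
  obtain ⟨c, M, -, -, -, hM⟩ := exists_roof_bounds hs
  set Q : (ℤ → Fin m) → ℂ := fun x => ∫ u in (0 : ℝ)..s (x 0), g x u with hQ
  have hQm : StronglyMeasurable Q := by
    have : Q = fun x => ∫ u, (suspension s).indicator (fun p => g p.1 p.2) (x, u) := by
      ext x
      rw [hQ]
      simp only
      rw [intervalIntegral.integral_of_le (hs _).le, ← integral_Ico_eq_integral_Ioc,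
        ← integral_indicator measurableSet_Ico]
      rfl
    rw [this]
    exact StronglyMeasurable.integral_prod_right (ν := volume)
      (f := fun x u => (suspension s).indicator (fun p => g p.1 p.2) (x, u))
      (hg.indicator (measurableSet_suspension s)).stronglyMeasurable
  have hQi : Integrable Q μ := by
    refine integrable_of_bound (K := |K| * M) hQm.aestronglyMeasurable fun x => ?_
    refine (intervalIntegral.norm_integral_le_of_norm_le_const fun u _ =>
      (hK x u).trans (le_abs_self K)).trans ?_
    rw [sub_zero, abs_of_pos (hs _)]
    gcongr
    exact hM _
  rw [integral_suspMeasure hs μ (G := fun p => g p.1 (p.2 + t))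
    (hg.comp (measurable_fst.prodMk (measurable_snd.add_const t))) (fun p => hK _ _),
    integral_suspMeasure hs μ (G := fun p => g p.1 p.2) hg (fun p => hK _ _)]
  congr 1
  have hkey (x : ℤ → Fin m) : ∫ u in (0 : ℝ)..s (x 0), g x (u + t) = Q x + (P (shift x) - P x) := by
    have h1 : P (shift x) = ∫ u in s (x 0)..s (x 0) + t, g x u := by
      simp only [hP, hshift]
      rw [intervalIntegral.integral_comp_add_right (g x), zero_add, add_comm t]
    rw [intervalIntegral.integral_comp_add_right (g x), zero_add, h1, hQ, hP]
    simp only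
    have h2 := intervalIntegral.integral_add_adjacent_intervals (hI x 0 t) (hI x t (s (x 0) + t))
    have h3 := intervalIntegral.integral_add_adjacent_intervals (hI x 0 (s (x 0)))
      (hI x (s (x 0)) (s (x 0) + t))
    rw [← sub_eq_iff_eq_add'.2 h2.symm, ← h3]
    ring
  simp_rw [hkey]
  have hinv : ∫ x, P (shift x) ∂μ = ∫ x, P x ∂μ := by
    conv_rhs => rw [← hμ.map_eq]
    exact (integral_map hμ.measurable.aemeasurable hPm.aestronglyMeasurable).symm
  have hsub : Integrable (fun x => P (shift x) - P x) μ := hPsi.sub hPi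
  rw [integral_add hQi hsub, integral_sub hPsi hPi, hinv, sub_self, add_zero]

/-! ### Spectral measures and twisted integrals -/

/-- The mean square of an integral over `[0,R]`, as a double integral of correlations. -/
theorem integral_norm_sq_intervalIntegral {Y : Type*} [MeasurableSpace Y] (ν : Measure Y)
    [IsFiniteMeasure ν] {g : Y → ℝ → ℂ} (hg : Measurable fun p : Y × ℝ => g p.1 p.2) {K : ℝ}
    (hK : ∀ y τ, ‖g y τ‖ ≤ K) {R : ℝ} (hR : 0 ≤ R) :
    ((∫ y, ‖∫ τ in (0 : ℝ)..R, g y τ‖ ^ 2 ∂ν : ℝ) : ℂ) =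
      ∫ q, ∫ y, g y q.1 * (starRingEnd ℂ) (g y q.2) ∂ν
        ∂((volume.restrict (Set.Ioc 0 R)).prod (volume.restrict (Set.Ioc 0 R))) := by
  have hm : Measurable fun p : Y × (ℝ × ℝ) => g p.1 p.2.1 * (starRingEnd ℂ) (g p.1 p.2.2) :=
    (hg.comp (measurable_fst.prodMk (measurable_fst.comp measurable_snd))).mul
      (Complex.continuous_conj.measurable.comp
        (hg.comp (measurable_fst.prodMk (measurable_snd.comp measurable_snd))))
  have hint : Integrable (Function.uncurry fun (q : ℝ × ℝ) y =>
      g y q.1 * (starRingEnd ℂ) (g y q.2))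
      (((volume.restrict (Set.Ioc 0 R)).prod (volume.restrict (Set.Ioc 0 R))).prod ν) := by
    refine integrable_of_bound (K := K * K) ?_ fun p => ?_
    · exact (hm.comp measurable_swap).aestronglyMeasurable
    · simp only [Function.uncurry, norm_mul, RCLike.norm_conj]
      exact mul_le_mul (hK _ _) (hK _ _) (norm_nonneg _) ((norm_nonneg _).trans (hK p.2 p.1.1))
  rw [integral_integral_swap hint, ← integral_complex_ofReal]
  congr 1
  ext y
  rw [integral_prod_mul (fun τ => g y τ) (fun τ => (starRingEnd ℂ) (g y τ)), integral_conj,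
    Complex.mul_conj, Complex.normSq_eq_norm_sq, intervalIntegral.integral_of_le hR]

/-- `k(η) = ∫_0^1 exp(-2πi η v) dv`. -/
noncomputable def expMean (η : ℝ) : ℂ := ∫ v in (0 : ℝ)..1, e (η * v)

theorem integral_e_mul (η R : ℝ) : ∫ τ in (0 : ℝ)..R, e (η * τ) = R * expMean (η * R) := by
  have := intervalIntegral.smul_integral_comp_mul_left (a := (0 : ℝ)) (b := 1)
    (fun τ => e (η * τ)) R
  rw [mul_zero, mul_one] at this
  rw [← this, expMean, Complex.real_smul]
  simp only [mul_assoc]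

theorem continuous_expMean : Continuous expMean :=
  intervalIntegral.continuous_parametric_intervalIntegral_of_continuous'
    (by unfold Function.uncurry; exact continuous_e.comp (by fun_prop)) 0 1

theorem norm_expMean_le (η : ℝ) : ‖expMean η‖ ≤ 1 := by
  simpa [expMean] using intervalIntegral.norm_integral_le_of_norm_le_const (a := (0 : ℝ)) (b := 1)
    (f := fun v => e (η * v)) (C := 1) fun v _ => (norm_e _).le

theorem e_eq_exp (t : ℝ) : e t = Complex.exp (((-2 * Real.pi * t : ℝ) : ℂ) * Complex.I) := by
  rw [e]; push_cast; ring_nf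

theorem half_le_norm_expMean {η : ℝ} (h : |η| ≤ 1 / (2 * Real.pi)) : 1 / 2 ≤ ‖expMean η‖ := by
  have hπ := Real.pi_pos
  have h0 (v : ℝ) (hv : v ∈ Set.uIoc (0 : ℝ) 1) : ‖e (η * v) - 1‖ ≤ 2 * Real.pi * |η| * v := by
    rw [Set.uIoc_of_le zero_le_one] at hv
    rw [e_eq_exp, mul_comm _ Complex.I]
    refine (Real.norm_exp_I_mul_ofReal_sub_one_le).trans_eq ?_
    rw [Real.norm_eq_abs, abs_mul, abs_mul, abs_mul, abs_of_pos hv.1, abs_of_pos hπ]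
    norm_num
    ring
  have hi : IntervalIntegrable (fun v => e (η * v)) volume 0 1 :=
    (continuous_e.comp (by fun_prop)).intervalIntegrable _ _
  have h1 : expMean η - 1 = ∫ v in (0 : ℝ)..1, (e (η * v) - 1) := by
    rw [intervalIntegral.integral_sub hi intervalIntegrable_const, expMean]
    simp
  have h2 : ‖expMean η - 1‖ ≤ ∫ v in (0 : ℝ)..1, 2 * Real.pi * |η| * v := by
    rw [h1]
    exact intervalIntegral.norm_integral_le_of_norm_le zero_le_one
      (Eventually.of_forall fun v hv => h0 v (by rwa [Set.uIoc_of_le zero_le_one]))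
      ((by fun_prop : Continuous fun v : ℝ => 2 * Real.pi * |η| * v).intervalIntegrable _ _)
  rw [intervalIntegral.integral_const_mul, integral_id] at h2
  rw [le_div_iff₀ (by positivity)] at h
  have h3 : ‖(1 : ℂ)‖ - ‖expMean η‖ ≤ ‖expMean η - 1‖ := by
    rw [norm_sub_rev]; exact norm_sub_norm_le _ _
  rw [norm_one] at h3
  linarith

theorem sq_norm_expMean (η : ℝ) :
    (2 * Real.pi * η) ^ 2 * ‖expMean η‖ ^ 2 = 2 - 2 * Real.cos (2 * Real.pi * η) := by
  rcases eq_or_ne η 0 with rfl | hη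
  · simp
  have hc : (-2 * Real.pi * Complex.I * η : ℂ) ≠ 0 := by
    simp [Real.pi_ne_zero, hη, Complex.I_ne_zero]
  have h1 : (-2 * Real.pi * Complex.I * η : ℂ) * expMean η = e η - 1 := by
    have : expMean η = ∫ v in (0 : ℝ)..1, Complex.exp ((-2 * Real.pi * Complex.I * η : ℂ) * v) := by
      rw [expMean]; congr 1; ext v; rw [e]; push_cast; ring_nf
    rw [this, integral_exp_mul_complex hc, ← mul_div_assoc, mul_div_cancel_left₀ _ hc]
    simp [e]
  have h2 := congrArg (fun w => ‖w‖ ^ 2) h1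
  simp only [norm_mul, norm_neg, Complex.norm_real, Complex.norm_I, Complex.norm_ofNat,
    Real.norm_eq_abs, mul_one, mul_pow, sq_abs] at h2
  rw [mul_pow, mul_pow, h2, ← Complex.normSq_eq_norm_sq, Complex.normSq_apply, e_eq_exp]
  simp only [Complex.sub_re, Complex.sub_im, Complex.exp_ofReal_mul_I_re,
    Complex.exp_ofReal_mul_I_im, Complex.one_re, Complex.one_im]
  have h3 : -2 * Real.pi * η = -(2 * Real.pi * η) := by ring
  rw [h3, Real.cos_neg, Real.sin_neg]
  nlinarith [Real.sin_sq_add_cos_sq (2 * Real.pi * η)]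

/-- Away from `0`, the Fejér-type kernel is bounded by its average over smaller scales. -/
theorem sq_norm_expMean_le_average {η R ρ : ℝ} (hρ : 0 < ρ) (h : 1 / ρ ≤ |η|) :
    R ^ 2 * ‖expMean (η * R)‖ ^ 2 ≤
      4 / ρ * ∫ τ in (0 : ℝ)..ρ, τ ^ 2 * ‖expMean (η * τ)‖ ^ 2 := by
  have hπ := Real.pi_pos
  have hη : 0 < |η| := (by positivity : 0 < 1 / ρ).trans_le h
  have hη0 : η ≠ 0 := abs_pos.1 hη
  have hsq : 0 < (2 * Real.pi * η) ^ 2 := by positivity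
  have hk (τ : ℝ) : τ ^ 2 * ‖expMean (η * τ)‖ ^ 2 =
      (2 - 2 * Real.cos (2 * Real.pi * η * τ)) / (2 * Real.pi * η) ^ 2 := by
    rw [eq_div_iff hsq.ne', mul_assoc (2 * Real.pi) η τ, ← sq_norm_expMean]; ring
  simp_rw [hk]
  rw [intervalIntegral.integral_div, intervalIntegral.integral_sub intervalIntegrable_const
    ((by fun_prop : Continuous fun τ : ℝ =>
      2 * Real.cos (2 * Real.pi * η * τ)).intervalIntegrable _ _),
    intervalIntegral.integral_const_mul,
    intervalIntegral.integral_comp_mul_left (fun τ => Real.cos τ) (by positivity), integral_cos,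
    mul_zero, Real.sin_zero, ← mul_div_assoc]
  gcongr
  simp only [intervalIntegral.integral_const, smul_eq_mul, sub_zero]
  have hs : (2 * Real.pi * η)⁻¹ * Real.sin (2 * Real.pi * η * ρ) ≤ ρ / 2 := by
    refine (le_abs_self _).trans ?_
    rw [abs_mul, abs_inv, abs_mul, abs_of_pos (by positivity : 0 < 2 * Real.pi)]
    rw [div_le_iff₀ hρ] at h
    rw [inv_mul_le_iff₀ (by positivity)]
    refine (Real.abs_sin_le_one _).trans (h.trans ?_)
    have : 1 ≤ Real.pi := by linarith [Real.pi_gt_three]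
    nlinarith [mul_pos hη hρ]
  have hcos := Real.neg_one_le_cos (2 * Real.pi * η * R)
  have h4 : (4 : ℝ) = 4 / ρ * ρ := by field_simp
  calc 2 - 2 * Real.cos (2 * Real.pi * η * R) ≤ 4 / ρ * ρ := by rw [← h4]; linarith
    _ ≤ _ := by gcongr; linarith

/-- The mean square over the suspension of the twisted integrals of the observable over a time
interval of length `R`. -/
noncomputable def meanSquare (s : Fin m → ℝ) (ψ : Fin m → ℝ → ℂ) (μ : Measure (ℤ → Fin m))
    (ω R : ℝ) : ℝ :=
  ∫ p, ‖∫ τ in (0 : ℝ)..R, e (ω * τ) * orbitFun s ψ p.1 (p.2 + τ)‖ ^ 2 ∂suspMeasure s μ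

/-- The mean square of twisted integrals is the integral of a Fejér-type kernel against the spectral
measure. -/
theorem meanSquare_eq [Nonempty (Fin m)] {s : Fin m → ℝ} (hs : ∀ j, 0 < s j)
    {ψ : Fin m → ℝ → ℂ} (hψ : ∀ j, ContinuousOn (ψ j) (Set.Icc 0 (s j)))
    {μ : Measure (ℤ → Fin m)} [IsProbabilityMeasure μ] (hμ : MeasurePreserving shift μ μ)
    {σ : Measure ℝ} (hσ : IsSpectralMeasure (suspMeasure s μ) (flow s) (cylindrical ψ) σ)
    (ω : ℝ) {R : ℝ} (hR : 0 ≤ R) :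
    meanSquare s ψ μ ω R = ∫ θ, R ^ 2 * ‖expMean ((ω - θ) * R)‖ ^ 2 ∂σ := by
  have := hσ.finite
  have := isProbabilityMeasure_suspMeasure hs μ
  obtain ⟨K, -, hK⟩ := exists_norm_orbitFun_le s hψ
  have hφ := measurable_orbitFun hs hψ
  have h1 := integral_norm_sq_intervalIntegral (suspMeasure s μ)
    (g := fun p τ => e (ω * τ) * orbitFun s ψ p.1 (p.2 + τ))
    ((continuous_e.measurable.comp (measurable_const.mul measurable_snd)).mul
      (hφ.comp ((measurable_fst.comp measurable_fst).prodMk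
        ((measurable_snd.comp measurable_fst).add measurable_snd))))
    (fun p τ => by rw [norm_mul, norm_e, one_mul]; exact hK _ _) hR
  have h2 := integral_norm_sq_intervalIntegral σ (g := fun θ τ => e ((ω - θ) * τ))
    (continuous_e.measurable.comp (by fun_prop)) (fun θ τ => (norm_e _).le) hR
  have h3 (θ : ℝ) : R ^ 2 * ‖expMean ((ω - θ) * R)‖ ^ 2 =
      ‖∫ τ in (0 : ℝ)..R, e ((ω - θ) * τ)‖ ^ 2 := by
    rw [integral_e_mul, norm_mul, mul_pow, Complex.norm_real, Real.norm_eq_abs, sq_abs]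
  simp_rw [h3]
  rw [meanSquare, ← Complex.ofReal_inj, h1, h2]
  congr 1
  ext ⟨τ, τ'⟩
  simp only
  have hconj (t : ℝ) : (starRingEnd ℂ) (e t) = e (-t) := by
    rw [e_eq_exp, e_eq_exp, ← Complex.exp_conj]
    congr 1
    rw [map_mul, Complex.conj_ofReal, Complex.conj_I]
    push_cast
    ring
  have h4 (p : (ℤ → Fin m) × ℝ) : e (ω * τ) * orbitFun s ψ p.1 (p.2 + τ) *
      (starRingEnd ℂ) (e (ω * τ') * orbitFun s ψ p.1 (p.2 + τ')) =
      e (ω * (τ - τ')) * (orbitFun s ψ p.1 (p.2 + τ' + (τ - τ')) *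
        (starRingEnd ℂ) (orbitFun s ψ p.1 (p.2 + τ'))) := by
    rw [show p.2 + τ' + (τ - τ') = p.2 + τ by ring, map_mul, hconj, mul_sub, sub_eq_add_neg, e_add]
    ring
  have h5 (θ : ℝ) : e ((ω - θ) * τ) * (starRingEnd ℂ) (e ((ω - θ) * τ')) =
      e (ω * (τ - τ')) * Complex.exp (2 * Real.pi * Complex.I * (θ : ℂ) * ((τ - τ' : ℝ) : ℂ)) := by
    rw [hconj, ← e_add, e, e, ← Complex.exp_add]
    congr 1
    push_cast
    ring
  simp_rw [h4, h5, integral_const_mul]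
  congr 1
  rw [hσ.fourier, integral_time_shift hs hμ
    (g := fun x u => orbitFun s ψ x (u + (τ - τ')) * (starRingEnd ℂ) (orbitFun s ψ x u))
    ((hφ.comp (measurable_fst.prodMk (measurable_snd.add_const _))).mul
      (Complex.continuous_conj.measurable.comp hφ)) (K := K * K)]
  · refine integral_congr_ae ?_
    filter_upwards [ae_mem_suspension s μ] with p hp
    rw [cylindrical_flow hs, cylindrical_eq_orbitFun hs ψ hp]
  · intro x u
    rw [norm_mul, RCLike.norm_conj]
    exact mul_le_mul (hK _ _) (hK _ _) (norm_nonneg _) ((norm_nonneg _).trans (hK x u))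
  · intro x u
    rw [orbitFun_shift hs, orbitFun_shift hs, add_right_comm]

theorem integrable_kernel {σ : Measure ℝ} [IsFiniteMeasure σ] (ω R : ℝ) :
    Integrable (fun θ => R ^ 2 * ‖expMean ((ω - θ) * R)‖ ^ 2) σ := by
  refine integrable_of_bound (K := R ^ 2) ?_ fun θ => ?_
  · have := continuous_expMean
    exact (by fun_prop : Continuous fun θ =>
      R ^ 2 * ‖expMean ((ω - θ) * R)‖ ^ 2).aestronglyMeasurable
  · rw [Real.norm_of_nonneg (by positivity)]
    exact mul_le_of_le_one_right (by positivity) (pow_le_one₀ (norm_nonneg _) (norm_expMean_le _))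

theorem measureReal_ball_le {σ : Measure ℝ} [IsFiniteMeasure σ] (ω : ℝ) {R : ℝ} (hR : 0 < R) :
    R ^ 2 / 4 * σ.real (Metric.ball ω (1 / (2 * Real.pi * R))) ≤
      ∫ θ, R ^ 2 * ‖expMean ((ω - θ) * R)‖ ^ 2 ∂σ := by
  have h1 : R ^ 2 / 4 * σ.real (Metric.ball ω (1 / (2 * Real.pi * R))) =
      ∫ θ, (Metric.ball ω (1 / (2 * Real.pi * R))).indicator (fun _ => R ^ 2 / 4) θ ∂σ := by
    rw [integral_indicator_const _ measurableSet_ball, smul_eq_mul, mul_comm]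
  rw [h1]
  refine integral_mono ((integrable_const _).indicator measurableSet_ball) (integrable_kernel ω R)
    fun θ => ?_
  by_cases hθ : θ ∈ Metric.ball ω (1 / (2 * Real.pi * R))
  swap
  · rw [Set.indicator_of_notMem hθ]
    positivity
  rw [Set.indicator_of_mem hθ]
  have h2 : 1 / 2 ≤ ‖expMean ((ω - θ) * R)‖ := by
    apply half_le_norm_expMean
    rw [Metric.mem_ball, dist_comm, Real.dist_eq] at hθ
    rw [abs_mul, abs_of_pos hR, ← le_div_iff₀ hR]
    refine hθ.le.trans_eq ?_
    field_simp
  nlinarith [sq_nonneg R, mul_self_nonneg (‖expMean ((ω - θ) * R)‖ - 1 / 2),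
    mul_le_mul h2 h2 (by norm_num) (norm_nonneg _)]

theorem integral_kernel_le {σ : Measure ℝ} [IsFiniteMeasure σ] (ω : ℝ) {R ρ B : ℝ} (hρ : 0 < ρ)
    (hB : ∀ τ ∈ Set.Icc 0 ρ, ∫ θ, τ ^ 2 * ‖expMean ((ω - θ) * τ)‖ ^ 2 ∂σ ≤ B) :
    ∫ θ, R ^ 2 * ‖expMean ((ω - θ) * R)‖ ^ 2 ∂σ ≤
      R ^ 2 * σ.real (Metric.ball ω (1 / ρ)) + 4 * B := by
  have hk := continuous_expMean
  have hcont : Continuous fun q : ℝ × ℝ => q.2 ^ 2 * ‖expMean ((ω - q.1) * q.2)‖ ^ 2 := by fun_prop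
  have hint : Integrable (Function.uncurry fun θ τ : ℝ => τ ^ 2 * ‖expMean ((ω - θ) * τ)‖ ^ 2)
      (σ.prod (volume.restrict (Set.Ioc 0 ρ))) := by
    refine Integrable.of_bound hcont.aestronglyMeasurable (ρ ^ 2) ?_
    have : ∀ᵐ q ∂(σ.prod (volume.restrict (Set.Ioc 0 ρ))), q.2 ∈ Set.Ioc 0 ρ :=
      Measure.quasiMeasurePreserving_snd.ae (ae_restrict_mem measurableSet_Ioc)
    filter_upwards [this] with q hq
    simp only [Function.uncurry]
    rw [Real.norm_of_nonneg (by positivity)]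
    refine (mul_le_of_le_one_right (by positivity)
      (pow_le_one₀ (norm_nonneg _) (norm_expMean_le _))).trans ?_
    exact pow_le_pow_left₀ hq.1.le hq.2 2
  have hswap := integral_integral_swap hint
  have hint' := hint.integral_prod_left
  simp only [Function.uncurry] at hint'
  have hpoint (θ : ℝ) : R ^ 2 * ‖expMean ((ω - θ) * R)‖ ^ 2 ≤
      (Metric.ball ω (1 / ρ)).indicator (fun _ => R ^ 2) θ +
        4 / ρ * ∫ τ in Set.Ioc 0 ρ, τ ^ 2 * ‖expMean ((ω - θ) * τ)‖ ^ 2 := by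
    have h0 : 0 ≤ ∫ τ in Set.Ioc 0 ρ, τ ^ 2 * ‖expMean ((ω - θ) * τ)‖ ^ 2 :=
      integral_nonneg fun τ => by positivity
    by_cases hθ : θ ∈ Metric.ball ω (1 / ρ)
    · rw [Set.indicator_of_mem hθ]
      have : R ^ 2 * ‖expMean ((ω - θ) * R)‖ ^ 2 ≤ R ^ 2 :=
        mul_le_of_le_one_right (by positivity) (pow_le_one₀ (norm_nonneg _) (norm_expMean_le _))
      have : 0 ≤ 4 / ρ * ∫ τ in Set.Ioc 0 ρ, τ ^ 2 * ‖expMean ((ω - θ) * τ)‖ ^ 2 := by positivity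
      linarith
    · rw [Set.indicator_of_notMem hθ, zero_add, ← intervalIntegral.integral_of_le hρ.le]
      apply sq_norm_expMean_le_average hρ
      rwa [Metric.mem_ball, dist_comm, Real.dist_eq, not_lt] at hθ
  have hi1 : Integrable ((Metric.ball ω (1 / ρ)).indicator fun _ => R ^ 2) σ :=
    (integrable_const _).indicator measurableSet_ball
  refine (integral_mono (integrable_kernel ω R) (hi1.add (hint'.const_mul (4 / ρ))) hpoint).trans ?_
  simp only [Pi.add_apply]
  rw [integral_add hi1 (hint'.const_mul _), integral_const_mul, hswap,
    integral_indicator_const _ measurableSet_ball, smul_eq_mul, mul_comm]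
  refine add_le_add le_rfl ?_
  have h5 : ∫ τ in Set.Ioc 0 ρ, ∫ θ, τ ^ 2 * ‖expMean ((ω - θ) * τ)‖ ^ 2 ∂σ ≤
      ∫ τ in Set.Ioc 0 ρ, B :=
    setIntegral_mono_on hint.integral_prod_right (integrable_const _) measurableSet_Ioc
      fun τ hτ => hB τ ⟨hτ.1.le, hτ.2⟩
  have h6 : ∫ τ in Set.Ioc 0 ρ, B = ρ * B := by
    simp [hρ.le]
  rw [h6] at h5
  calc 4 / ρ * _ ≤ 4 / ρ * (ρ * B) := by gcongr
    _ = 4 * B := by field_simp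

/-! ### Bounds for mean squares of twisted integrals -/

theorem norm_integral_time_shift (f : ℝ → ℂ) (ω t R : ℝ) :
    ‖∫ τ in (0 : ℝ)..R, e (ω * τ) * f (t + τ)‖ = ‖∫ u in t..t + R, e (ω * u) * f u‖ := by
  have h := intervalIntegral.integral_comp_add_left (a := 0) (b := R)
    (fun u => e (ω * u) * f u) t
  rw [add_zero] at h
  rw [← h]
  have h2 (τ : ℝ) : e (ω * (t + τ)) * f (t + τ) = e (ω * t) * (e (ω * τ) * f (t + τ)) := by
    rw [mul_add, e_add, mul_assoc]
  simp_rw [h2]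
  rw [intervalIntegral.integral_const_mul, norm_mul, norm_e, one_mul]

/-- A bound for the twisted integrals over all orbits in the support of `μ` bounds their mean
square. -/
theorem meanSquare_le [Nonempty (Fin m)] {s : Fin m → ℝ} (hs : ∀ j, 0 < s j)
    {ψ : Fin m → ℝ → ℂ} {μ : Measure (ℤ → Fin m)} [IsProbabilityMeasure μ]
    {X : Set (ℤ → Fin m)} (hX : ∀ᵐ x ∂μ, x ∈ X) {ω R B : ℝ}
    (hB : ∀ x ∈ X, ∀ t : ℝ, ‖∫ u in t..t + R, e (ω * u) * orbitFun s ψ x u‖ ≤ B) :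
    meanSquare s ψ μ ω R ≤ B ^ 2 := by
  have := isProbabilityMeasure_suspMeasure hs μ
  have h : ∀ᵐ p ∂suspMeasure s μ,
      ‖∫ τ in (0 : ℝ)..R, e (ω * τ) * orbitFun s ψ p.1 (p.2 + τ)‖ ^ 2 ≤ B ^ 2 := by
    filter_upwards [ae_fst_suspMeasure s hX] with p hp
    rw [norm_integral_time_shift (orbitFun s ψ p.1)]
    exact pow_le_pow_left₀ (norm_nonneg _) (hB p.1 hp p.2) 2
  refine (integral_mono_of_nonneg (Eventually.of_forall fun p => by positivity)
    (integrable_const (B ^ 2)) h).trans_eq ?_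
  simp

theorem integrable_sq_norm_integral [Nonempty (Fin m)] {s : Fin m → ℝ} (hs : ∀ j, 0 < s j)
    {ψ : Fin m → ℝ → ℂ} (hψ : ∀ j, ContinuousOn (ψ j) (Set.Icc 0 (s j)))
    (μ : Measure (ℤ → Fin m)) [IsProbabilityMeasure μ] (ω R : ℝ) :
    Integrable (fun p : (ℤ → Fin m) × ℝ =>
      ‖∫ τ in (0 : ℝ)..R, e (ω * τ) * orbitFun s ψ p.1 (p.2 + τ)‖ ^ 2) (suspMeasure s μ) := by
  have := isProbabilityMeasure_suspMeasure hs μ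
  obtain ⟨K, -, hK⟩ := exists_norm_orbitFun_le s hψ
  have hm : StronglyMeasurable (Function.uncurry fun (p : (ℤ → Fin m) × ℝ) (τ : ℝ) =>
      e (ω * τ) * orbitFun s ψ p.1 (p.2 + τ)) :=
    ((continuous_e.measurable.comp (measurable_const.mul measurable_snd)).mul
      ((measurable_orbitFun hs hψ).comp ((measurable_fst.comp measurable_fst).prodMk
        ((measurable_snd.comp measurable_fst).add measurable_snd)))).stronglyMeasurable
  refine integrable_of_bound (K := (K * |R - 0|) ^ 2) ?_ fun p => ?_
  · simp only [intervalIntegral]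
    exact (((hm.integral_prod_right.sub hm.integral_prod_right).norm).pow 2).aestronglyMeasurable
  · rw [Real.norm_of_nonneg (by positivity)]
    refine pow_le_pow_left₀ (norm_nonneg _) ?_ 2
    exact intervalIntegral.norm_integral_le_of_norm_le_const fun u _ => by
      rw [norm_mul, norm_e, one_mul]; exact hK _ _

/-- If the twisted integrals are large on the orbits starting in `D`, then their mean square is
large in proportion to the measure of `D`. -/
theorem le_meanSquare [Nonempty (Fin m)] {s : Fin m → ℝ} (hs : ∀ j, 0 < s j)
    {ψ : Fin m → ℝ → ℂ} (hψ : ∀ j, ContinuousOn (ψ j) (Set.Icc 0 (s j))) {c : ℝ} (hc0 : 0 < c)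
    (hc : ∀ j, c ≤ s j) {μ : Measure (ℤ → Fin m)} [IsProbabilityMeasure μ]
    {X D : Set (ℤ → Fin m)} (hX : ∀ᵐ x ∂μ, x ∈ X) (hD : MeasurableSet D) {ω R A : ℝ} (hA : 0 ≤ A)
    (h : ∀ x ∈ X, x ∈ D → ∀ t, 0 ≤ t → t < s (x 0) →
      A ≤ ‖∫ u in t..t + R, e (ω * u) * orbitFun s ψ x u‖) :
    c * ((μ.prod volume) (suspension s)).toReal⁻¹ * μ.real D * A ^ 2 ≤ meanSquare s ψ μ ω R := by
  have := isProbabilityMeasure_suspMeasure hs μ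
  have hDm : MeasurableSet (Prod.fst ⁻¹' D : Set ((ℤ → Fin m) × ℝ)) := measurable_fst hD
  have h1 : ∀ᵐ p ∂suspMeasure s μ, (Prod.fst ⁻¹' D).indicator (fun _ => A ^ 2) p ≤
      ‖∫ τ in (0 : ℝ)..R, e (ω * τ) * orbitFun s ψ p.1 (p.2 + τ)‖ ^ 2 := by
    filter_upwards [ae_fst_suspMeasure s hX, ae_mem_suspension s μ] with p hp hp'
    by_cases hpD : p ∈ Prod.fst ⁻¹' D
    · rw [Set.indicator_of_mem hpD, norm_integral_time_shift (orbitFun s ψ p.1)]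
      exact pow_le_pow_left₀ hA (h p.1 hp hpD p.2 hp'.1 hp'.2) 2
    · rw [Set.indicator_of_notMem hpD]
      positivity
  refine le_trans ?_ (integral_mono_ae ((integrable_const _).indicator hDm)
    (integrable_sq_norm_integral hs hψ μ ω R) h1)
  rw [integral_indicator_const _ hDm, smul_eq_mul]
  refine mul_le_mul_of_nonneg_right ?_ (by positivity)
  have h2 : (suspMeasure s μ).real (Prod.fst ⁻¹' D) =
      ((μ.prod volume) (suspension s)).toReal⁻¹ *
        ((μ.prod volume) (Prod.fst ⁻¹' D ∩ suspension s)).toReal := by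
    rw [measureReal_def, suspMeasure, Measure.smul_apply, Measure.restrict_apply hDm, smul_eq_mul,
      ENNReal.toReal_mul, ENNReal.toReal_inv]
  rw [h2, mul_assoc, mul_left_comm]
  refine mul_le_mul_of_nonneg_left ?_ (by positivity)
  have h3 := ENNReal.toReal_mono
    ((measure_mono Set.inter_subset_right).trans_lt (prod_suspension_lt_top hs μ)).ne
    (le_prod_suspension hc μ (D := D))
  rwa [ENNReal.toReal_mul, ENNReal.toReal_ofReal hc0.le, mul_comm] at h3

/-! ### Frequency of occurrence of words -/

theorem shift_iterate_apply (x : ℤ → Fin m) (j : ℕ) (i : ℤ) : shift^[j] x i = x (i + j) := by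
  induction j generalizing x with
  | zero => simp
  | succ j ih => rw [Function.iterate_succ_apply, ih, shift]; push_cast; ring_nf

theorem factor_shift_iterate (x : ℤ → Fin m) (j : ℕ) (i : ℤ) (ℓ : ℕ) :
    factor (shift^[j] x) i ℓ = factor x (i + j) ℓ := by
  simp only [factor, shift_iterate_apply]
  congr 1
  ext k
  rw [add_right_comm]

/-- The set of points `x` such that `w` occurs in `x` at one of the positions `0, -1, …, -(J-1)`. -/
def recentOccurrence (w : List (Fin m)) (J : ℕ) : Set (ℤ → Fin m) :=
  {x | ∃ i < J, factor x (-(i : ℤ)) w.length = w}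

theorem measurableSet_recentOccurrence (w : List (Fin m)) (J : ℕ) :
    MeasurableSet (recentOccurrence w J) := by
  have h (i : ℤ) : MeasurableSet {x : ℤ → Fin m | factor x i w.length = w} := by
    have hm : Measurable fun (x : ℤ → Fin m) (k : Fin w.length) => x (i + (k : ℕ)) :=
      measurable_pi_lambda _ fun k => measurable_pi_apply _
    exact hm (Set.toFinite {v : Fin w.length → Fin m | List.ofFn v = w}).measurableSet
  have h2 : recentOccurrence w J =
      ⋃ i ∈ Finset.range J, {x : ℤ → Fin m | factor x (-(i : ℤ)) w.length = w} := by
    ext x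
    simp [recentOccurrence]
  rw [h2]
  exact Finset.measurableSet_biUnion _ fun i _ => h _

/-- If `w` occurs in every window of length `L`, then a proportion `J / (L + J)` of the points has
seen `w` within the last `J` steps. -/
theorem le_measure_recentOccurrence {μ : Measure (ℤ → Fin m)} [IsProbabilityMeasure μ]
    (hμ : MeasurePreserving shift μ μ) {X : Set (ℤ → Fin m)} (hX : ∀ᵐ x ∂μ, x ∈ X)
    {w : List (Fin m)} {L : ℕ}
    (hw : ∀ x ∈ X, ∃ j : ℕ, j < L ∧ factor x j w.length = w) (J : ℕ) :
    (J : ℝ) ≤ (L + J) * μ.real (recentOccurrence w J) := by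
  set D := recentOccurrence w J
  have hD : MeasurableSet D := measurableSet_recentOccurrence w J
  have h1 : ∀ᵐ x ∂μ, (J : ℝ) ≤ ∑ j ∈ Finset.range (L + J),
      (shift^[j] ⁻¹' D).indicator (fun _ => (1 : ℝ)) x := by
    filter_upwards [hX] with x hx
    obtain ⟨j₀, hj₀, hj₀'⟩ := hw x hx
    have hsub : Finset.Ico j₀ (j₀ + J) ⊆ Finset.range (L + J) := fun j hj => by
      simp only [Finset.mem_Ico, Finset.mem_range] at *
      omega
    have hmem : ∀ j ∈ Finset.Ico j₀ (j₀ + J),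
        (shift^[j] ⁻¹' D).indicator (fun _ => (1 : ℝ)) x = 1 := fun j hj => by
      rw [Finset.mem_Ico] at hj
      have hind : x ∈ shift^[j] ⁻¹' D → (shift^[j] ⁻¹' D).indicator (fun _ => (1 : ℝ)) x = 1 :=
        fun h => Set.indicator_of_mem h _
      refine hind ⟨j - j₀, by omega, ?_⟩
      rw [factor_shift_iterate, Nat.cast_sub hj.1]
      rw [show -((j : ℤ) - j₀) + j = j₀ by ring]
      exact hj₀'
    have hle := Finset.sum_le_sum_of_subset_of_nonneg
      (f := fun j => (shift^[j] ⁻¹' D).indicator (fun _ => (1 : ℝ)) x) hsub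
      fun j _ _ => Set.indicator_nonneg (fun _ _ => zero_le_one) x
    refine le_trans ?_ hle
    rw [Finset.sum_congr rfl hmem]
    simp
  have hi (j : ℕ) : Integrable ((shift^[j] ⁻¹' D).indicator fun _ => (1 : ℝ)) μ :=
    (integrable_const _).indicator ((hμ.iterate j).measurable hD)
  have h2 := integral_mono_ae (integrable_const (μ := μ) (J : ℝ))
    (integrable_finsetSum (Finset.range (L + J)) fun j _ => hi j) h1
  rw [integral_finsetSum _ fun j _ => hi j] at h2
  have h3 (j : ℕ) : ∫ x, (shift^[j] ⁻¹' D).indicator (fun _ => (1 : ℝ)) x ∂μ = μ.real D := by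
    rw [integral_indicator_const _ ((hμ.iterate j).measurable hD), smul_eq_mul, mul_one,
      measureReal_def, (hμ.iterate j).measure_preimage hD.nullMeasurableSet, measureReal_def]
  simp only [h3] at h2
  simpa using h2

/-- If the twisted sum over `w` has modulus `A` and the twisted integrals over intervals of length
`(J + 1) M` are at most `A / 4`, then the twisted integrals over intervals of the length of `w`
are at least `A / 2` on all orbits that have seen `w` within the last `J` steps. -/
theorem half_le_norm_integral_of_recentOccurrence {s : Fin m → ℝ} (hs : ∀ j, 0 < s j) {M : ℝ}
    (hM : ∀ j, s j ≤ M) {ψ : Fin m → ℝ → ℂ} (hψ : ∀ j, ContinuousOn (ψ j) (Set.Icc 0 (s j)))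
    {ω : ℝ} {ξ : Fin m → ℝ} {z : Fin m → ℂ} (hξ : ∀ j, ∃ k : ℤ, ξ j = ω * s j + k)
    (hz : ∀ j, z j = fourierOn (s j) (ψ j) ω) {w : List (Fin m)} {J : ℕ} {x : ℤ → Fin m}
    (hx : x ∈ recentOccurrence w J)
    (hB : ∀ t R : ℝ, 0 ≤ R → R ≤ (J + 1) * M →
      ‖∫ u in t..t + R, e (ω * u) * orbitFun s ψ x u‖ ≤ ‖twistedSum ξ z w‖ / 4)
    {t : ℝ} (ht : 0 ≤ t) (ht' : t < s (x 0)) :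
    ‖twistedSum ξ z w‖ / 2 ≤
      ‖∫ u in t..t + (w.map s).sum, e (ω * u) * orbitFun s ψ x u‖ := by
  obtain ⟨i, hi, hw⟩ := hx
  set P := roofSum s x (-(i : ℤ)) with hP
  set H := (w.map s).sum
  have hM0 : 0 ≤ M := (hs (x 0)).le.trans (hM _)
  have hsum := roofSum_add s x (-(i : ℤ)) i
  rw [neg_add_cancel, roofSum_zero] at hsum
  have hP0 : P ≤ 0 := by
    rw [← roofSum_zero s x]
    exact (strictMono_roofSum hs x).monotone (by omega)
  have hPJ : -P ≤ J * M := by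
    have h1 := sum_map_le hM (factor x (-(i : ℤ)) i)
    rw [length_factor] at h1
    have h2 : (i : ℝ) ≤ J := by exact_mod_cast hi.le
    have h3 := mul_le_mul_of_nonneg_right h2 hM0
    linarith
  have htP : t - P ≤ (J + 1) * M := by linarith [hM (x 0)]
  have hI := intervalIntegrable_orbitFun hs hψ ω x
  have hmain : ‖∫ u in P..P + H, e (ω * u) * orbitFun s ψ x u‖ = ‖twistedSum ξ z w‖ := by
    have h4 : P + H = roofSum s x (-(i : ℤ) + w.length) := by rw [roofSum_add, hw]
    rw [h4, integral_orbitFun_factor hs hψ hξ hz, norm_mul, norm_e, one_mul, hw]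
  have h1 := hB P (t - P) (by linarith) htP
  have h2 := hB (P + H) (t - P) (by linarith) htP
  rw [show P + (t - P) = t by ring] at h1
  rw [show P + H + (t - P) = t + H by ring] at h2
  have h5 := intervalIntegral.integral_add_adjacent_intervals (hI P t) (hI t (t + H))
  have h6 := intervalIntegral.integral_add_adjacent_intervals (hI P (P + H)) (hI (P + H) (t + H))
  have h7 : ∫ u in P..P + H, e (ω * u) * orbitFun s ψ x u =
      (∫ u in P..t, e (ω * u) * orbitFun s ψ x u) +
      (∫ u in t..t + H, e (ω * u) * orbitFun s ψ x u) -
      ∫ u in P + H..t + H, e (ω * u) * orbitFun s ψ x u := by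
    rw [h5, ← h6, add_sub_cancel_right]
  have h8 := norm_sub_le ((∫ u in P..t, e (ω * u) * orbitFun s ψ x u) +
      (∫ u in t..t + H, e (ω * u) * orbitFun s ψ x u))
      (∫ u in P + H..t + H, e (ω * u) * orbitFun s ψ x u)
  rw [← h7, hmain] at h8
  have h9 := norm_add_le (∫ u in P..t, e (ω * u) * orbitFun s ψ x u)
      (∫ u in t..t + H, e (ω * u) * orbitFun s ψ x u)
  linarith

/-! ### Local dimension of the spectral measure -/

theorem le_log_div_log {σ : Measure ℝ} [IsFiniteMeasure σ] {S : Set ℝ} {r c : ℝ} (hr : 0 < r)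
    (hr1 : r < 1) (h : σ.real S ≤ r ^ c) :
    (c : EReal) ≤ ENNReal.log (σ S) / ((Real.log r : ℝ) : EReal) := by
  have hlog := Real.log_neg hr hr1
  have h1 : ENNReal.log (σ S) ≤ ((c * Real.log r : ℝ) : EReal) := by
    rw [← Real.log_rpow hr, ← ENNReal.log_ofReal_of_pos (Real.rpow_pos_of_pos hr c)]
    exact ENNReal.log_monotone (by rw [← ofReal_measureReal]; exact ENNReal.ofReal_le_ofReal h)
  refine le_trans ?_ (EReal.div_le_div_right_of_nonpos (by exact_mod_cast hlog.le) h1)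
  rw [← EReal.coe_div, mul_div_cancel_right₀ _ hlog.ne]

theorem log_div_log_le {σ : Measure ℝ} [IsFiniteMeasure σ] {S : Set ℝ} {r c : ℝ} (hr : 0 < r)
    (hr1 : r < 1) (h : r ^ c ≤ σ.real S) :
    ENNReal.log (σ S) / ((Real.log r : ℝ) : EReal) ≤ (c : EReal) := by
  have hlog := Real.log_neg hr hr1
  have h1 : ((c * Real.log r : ℝ) : EReal) ≤ ENNReal.log (σ S) := by
    rw [← Real.log_rpow hr, ← ENNReal.log_ofReal_of_pos (Real.rpow_pos_of_pos hr c)]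
    exact ENNReal.log_monotone (by rw [← ofReal_measureReal]; exact ENNReal.ofReal_le_ofReal h)
  refine (EReal.div_le_div_right_of_nonpos (by exact_mod_cast hlog.le) h1).trans ?_
  rw [← EReal.coe_div, mul_div_cancel_right₀ _ hlog.ne]

/-- Bounds `O(R^β)` on the twisted integrals give the lower bound `2 - 2β` for the local
dimension. -/
theorem le_lowerLocalDim [Nonempty (Fin m)] {s : Fin m → ℝ} (hs : ∀ j, 0 < s j)
    {ψ : Fin m → ℝ → ℂ} (hψ : ∀ j, ContinuousOn (ψ j) (Set.Icc 0 (s j)))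
    {μ : Measure (ℤ → Fin m)} [IsProbabilityMeasure μ] (hμ : MeasurePreserving shift μ μ)
    {σ : Measure ℝ} (hσ : IsSpectralMeasure (suspMeasure s μ) (flow s) (cylindrical ψ) σ)
    {X : Set (ℤ → Fin m)} (hX : ∀ᵐ x ∂μ, x ∈ X) {ω C β : ℝ} (hC : 0 < C) (hβ : 0 < β)
    (hB : ∀ x ∈ X, ∀ t R : ℝ, 0 ≤ R →
      ‖∫ u in t..t + R, e (ω * u) * orbitFun s ψ x u‖ ≤ C * (1 + R) ^ β) :
    ((2 - 2 * β : ℝ) : EReal) ≤ lowerLocalDim σ ω := by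
  have := hσ.finite
  have hπ := Real.pi_pos
  refine EReal.ge_of_forall_gt_iff_ge.1 fun c hc => ?_
  have hc' : c < 2 - 2 * β := by exact_mod_cast hc
  refine Filter.le_liminf_of_le (by isBoundedDefault) ?_
  set E := 4 * (C * 2 ^ β) ^ 2 * (2 * Real.pi) ^ (2 - 2 * β) with hE
  have hE0 : 0 < E := by positivity
  -- the constant `E` is absorbed by a small power of `r`
  have hsmall : ∀ᶠ r : ℝ in 𝓝[>] 0, E * r ^ (2 - 2 * β - c) < 1 := by
    have h0 : 0 < 2 - 2 * β - c := by linarith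
    have : Tendsto (fun r : ℝ => E * r ^ (2 - 2 * β - c)) (𝓝[>] 0) (𝓝 (E * 0 ^ (2 - 2 * β - c))) :=
      ((Real.continuousAt_rpow_const 0 _ (Or.inr h0.le)).tendsto.mono_left
        nhdsWithin_le_nhds).const_mul E
    rw [Real.zero_rpow h0.ne', mul_zero] at this
    exact this.eventually (gt_mem_nhds zero_lt_one)
  have hr1 : ∀ᶠ r : ℝ in 𝓝[>] 0, r < 1 / (2 * Real.pi) :=
    nhdsWithin_le_nhds (gt_mem_nhds (by positivity))
  filter_upwards [hsmall, hr1, self_mem_nhdsWithin] with r hrE hr1 hr0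
  have hr0 : 0 < r := hr0
  have hr_lt : r < 1 := hr1.trans_le (by
    rw [div_le_one (by positivity)]; linarith [Real.pi_gt_three])
  refine le_log_div_log hr0 hr_lt ?_
  set R := 1 / (2 * Real.pi * r) with hR
  have hR0 : 0 < R := by positivity
  have hR1 : 1 ≤ R := by
    rw [hR, le_div_iff₀ (by positivity)]
    rw [lt_div_iff₀ (by positivity)] at hr1
    linarith
  have hrR : 1 / (2 * Real.pi * R) = r := by rw [hR]; field_simp
  have h1 := measureReal_ball_le (σ := σ) ω hR0
  rw [← meanSquare_eq hs hψ hμ hσ ω hR0.le, hrR] at h1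
  have h2 := h1.trans (meanSquare_le hs hX fun x hx t => hB x hx t R hR0.le)
  have h3 : (C * (1 + R) ^ β) ^ 2 ≤ (C * 2 ^ β) ^ 2 * R ^ (2 * β) := by
    have h4 : (1 + R) ^ β ≤ 2 ^ β * R ^ β := by
      rw [← Real.mul_rpow (by norm_num) hR0.le]
      exact Real.rpow_le_rpow (by linarith) (by linarith) hβ.le
    have h5 : R ^ (2 * β) = (R ^ β) ^ 2 := by
      rw [mul_comm, Real.rpow_mul hR0.le, Real.rpow_two]
    rw [h5, ← mul_pow, mul_assoc]
    gcongr
  have h6 : σ.real (Metric.ball ω r) ≤ 4 * (C * 2 ^ β) ^ 2 * R ^ (2 * β - 2) := by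
    rw [Real.rpow_sub hR0, Real.rpow_two, ← mul_div_assoc, le_div_iff₀ (by positivity)]
    linarith [h2.trans h3]
  have h7 : R ^ (2 * β - 2) = (2 * Real.pi) ^ (2 - 2 * β) * r ^ (2 - 2 * β) := by
    rw [hR, one_div, Real.inv_rpow (by positivity), ← Real.rpow_neg (by positivity), neg_sub,
      Real.mul_rpow (by positivity) hr0.le]
  rw [h7, ← mul_assoc, ← hE] at h6
  refine h6.trans ?_
  have h8 : r ^ (2 - 2 * β) = r ^ (2 - 2 * β - c) * r ^ c := by
    rw [← Real.rpow_add hr0]; ring_nf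
  rw [h8, ← mul_assoc]
  exact mul_le_of_le_one_left (by positivity) hrE.le

/-- The mean square at scale `R` is bounded by `R² σ(B_r)` and a tail, which bounds for the twisted
integrals at the scales up to `ρ = 1/r` control. -/
theorem meanSquare_le_ball [Nonempty (Fin m)] {s : Fin m → ℝ} (hs : ∀ j, 0 < s j)
    {ψ : Fin m → ℝ → ℂ} (hψ : ∀ j, ContinuousOn (ψ j) (Set.Icc 0 (s j)))
    {μ : Measure (ℤ → Fin m)} [IsProbabilityMeasure μ] (hμ : MeasurePreserving shift μ μ)
    {σ : Measure ℝ} (hσ : IsSpectralMeasure (suspMeasure s μ) (flow s) (cylindrical ψ) σ)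
    {X : Set (ℤ → Fin m)} (hX : ∀ᵐ x ∂μ, x ∈ X) {ω C β : ℝ} (hC : 0 < C) (hβ : 0 < β)
    (hB : ∀ x ∈ X, ∀ t R : ℝ, 0 ≤ R →
      ‖∫ u in t..t + R, e (ω * u) * orbitFun s ψ x u‖ ≤ C * (1 + R) ^ β)
    {R ρ : ℝ} (hR : 0 ≤ R) (hρ : 0 < ρ) :
    meanSquare s ψ μ ω R ≤
      R ^ 2 * σ.real (Metric.ball ω (1 / ρ)) + 4 * (C * (1 + ρ) ^ β) ^ 2 := by
  have := hσ.finite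
  rw [meanSquare_eq hs hψ hμ hσ ω hR]
  refine integral_kernel_le ω hρ fun τ hτ => ?_
  rw [← meanSquare_eq hs hψ hμ hσ ω hτ.1]
  refine meanSquare_le hs hX fun x hx t => (hB x hx t τ hτ.1).trans ?_
  have : (1 + τ) ^ β ≤ (1 + ρ) ^ β :=
    Real.rpow_le_rpow (by linarith [hτ.1]) (by linarith [hτ.2]) hβ.le
  gcongr

/-! ### Choice of scales and the upper bound for the local dimension -/

theorem eventually_mul_exp_le {p q : ℝ} (h : p < q) (C : ℝ) {D : ℝ} (hD : 0 < D) :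
    ∀ᶠ n : ℕ in atTop, C * Real.exp (p * n) ≤ D * Real.exp (q * n) := by
  have htend : Tendsto (fun n : ℕ => Real.exp ((q - p) * n)) atTop atTop :=
    Real.tendsto_exp_atTop.comp
      (tendsto_natCast_atTop_atTop.const_mul_atTop (by linarith))
  filter_upwards [htend.eventually_ge_atTop (C / D)] with n hn
  rw [div_le_iff₀ hD] at hn
  calc C * Real.exp (p * n) ≤ Real.exp ((q - p) * n) * D * Real.exp (p * n) := by gcongr
    _ = D * (Real.exp ((q - p) * n) * Real.exp (p * n)) := by ring
    _ = D * Real.exp (q * n) := by rw [← Real.exp_add]; ring_nf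

theorem eventually_exists_fullBlock {a : ℕ → Subst m} (hadm : ∀ n, (a n).Admissible)
    (hA1 : CondA1' a) {δ : ℝ} (hδ : 0 < δ) :
    ∀ᶠ n : ℕ in atTop, ∃ N : ℕ, n ≤ N ∧ (N : ℝ) ≤ (1 + δ) * n ∧ FullBlock a n N := by
  set ε := δ / 2 / (1 + δ) with hε
  have hε0 : 0 < ε := by positivity
  have hε1 : ε ≤ 1 := by rw [hε, div_le_one (by positivity)]; linarith
  obtain ⟨n₀, hn₀⟩ := exists_fullBlock hadm hA1 hε0
  filter_upwards [eventually_ge_atTop n₀, eventually_ge_atTop ⌈2 / δ⌉₊] with n hn hn'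
  have hn'' : 2 / δ ≤ n := Nat.ceil_le.1 hn'
  rw [div_le_iff₀ hδ] at hn''
  set N := ⌊(1 + δ) * n⌋₊ with hN
  have h1 : (N : ℝ) ≤ (1 + δ) * n := Nat.floor_le (by positivity)
  have h2 : (1 + δ) * n - 1 ≤ N := (Nat.sub_one_lt_floor _).le
  have h3 : n ≤ N := Nat.le_floor (by nlinarith [(Nat.cast_nonneg n : (0 : ℝ) ≤ n)])
  have h4 : n ≤ ⌊(N : ℝ) * (1 - ε)⌋₊ := by
    apply Nat.le_floor
    have h5 := mul_le_mul_of_nonneg_right h2 (show 0 ≤ 1 - ε by linarith)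
    have h6 : (1 + δ) * ε = δ / 2 := by rw [hε]; field_simp
    have h7 : ((1 + δ) * n - 1) * (1 - ε) = n + δ * n - (1 + δ) * ε * n - (1 - ε) := by ring
    rw [h7, h6] at h5
    linarith
  have h8 : ⌊(N : ℝ) * (1 - ε)⌋₊ ≤ N :=
    Nat.floor_le_of_le (mul_le_of_le_one_right (Nat.cast_nonneg N) (by linarith))
  exact ⟨N, h3, h1, (hn₀ N (hn.trans h3)).mono_left hadm h4 h8⟩

/-- The auxiliary exponents in the upper bound for the local dimension can be chosen arbitrarily
close to their ideal values. -/
theorem exists_small_parameters {lam χ c : ℝ} (hlam : 0 < lam) (hχ : 0 < χ)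
    (hc : 2 - 2 * χ / lam < c) :
    ∃ θ δ : ℝ, 0 < θ ∧ θ < lam ∧ 0 < δ ∧ δ < χ ∧
      2 * ((χ + δ) / lam) * (lam - θ) <
        (χ - δ) / ((χ + δ) / lam) - (lam + δ) * (1 + δ) + 2 * (χ - δ) ∧
      2 * (lam + δ) - ((χ - δ) / ((χ + δ) / lam) - (lam + δ) * (1 + δ) + 2 * (χ - δ)) <
        c * (lam - θ) := by
  have h1 : 2 * lam - 2 * χ < c * (lam - 0) := by
    rw [sub_zero, ← div_lt_iff₀ hlam]
    refine lt_of_eq_of_lt ?_ hc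
    field_simp
  have h2 : ∀ᶠ θ in 𝓝[>] (0 : ℝ), 2 * lam - 2 * χ < c * (lam - θ) :=
    nhdsWithin_le_nhds ((by fun_prop : ContinuousAt (fun θ : ℝ => c * (lam - θ)) 0).eventually
      (lt_mem_nhds h1))
  obtain ⟨θ, ⟨hθ, hθ'⟩, hθ0⟩ := ((h2.and (nhdsWithin_le_nhds (gt_mem_nhds hlam))).and
    self_mem_nhdsWithin).exists
  have hθ0 : 0 < θ := hθ0
  have hb : (χ + 0) / lam ≠ 0 := by rw [add_zero]; positivity
  set E : ℝ → ℝ := fun δ => (χ - δ) / ((χ + δ) / lam) - (lam + δ) * (1 + δ) + 2 * (χ - δ) with hE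
  have hEc : ContinuousAt E 0 := by
    have : ContinuousAt (fun δ : ℝ => (χ - δ) / ((χ + δ) / lam)) 0 :=
      ContinuousAt.div (by fun_prop) (by fun_prop) hb
    rw [hE]
    fun_prop
  have hE0 : E 0 = 2 * χ := by
    simp only [hE]
    field_simp
    ring
  have h3 : ∀ᶠ δ in 𝓝[>] (0 : ℝ), 2 * ((χ + δ) / lam) * (lam - θ) < E δ := by
    refine nhdsWithin_le_nhds (ContinuousAt.eventually_lt (by fun_prop) hEc ?_)
    rw [hE0, add_zero, mul_assoc, div_mul_eq_mul_div]
    have : χ * (lam - θ) / lam < χ := by rw [div_lt_iff₀ hlam]; nlinarith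
    linarith
  have h4 : ∀ᶠ δ in 𝓝[>] (0 : ℝ), 2 * (lam + δ) - E δ < c * (lam - θ) := by
    refine nhdsWithin_le_nhds (ContinuousAt.eventually_lt (by fun_prop) (by fun_prop) ?_)
    rw [hE0, add_zero]
    exact hθ
  obtain ⟨δ, ⟨⟨h3, h4⟩, h5⟩, hδ⟩ := (((h3.and h4).and
    (nhdsWithin_le_nhds (gt_mem_nhds hχ))).and self_mem_nhdsWithin).exists
  exact ⟨θ, δ, hθ0, hθ', hδ, h5, h3, h4⟩

/-- The cocycle being large infinitely often makes the spectral measure of balls large for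
arbitrarily small radii. -/
theorem lowerLocalDim_le [Nonempty (Fin m)] {a : ℕ → Subst m} (hadm : ∀ n, (a n).Admissible)
    (hA1 : CondA1' a) {lam : ℝ} (hA2 : CondA2 a lam) (hA3 : CondA3 a) (hlam : 0 < lam)
    {μ : Measure (ℤ → Fin m)} [IsProbabilityMeasure μ] (hμ : MeasurePreserving shift μ μ)
    (hX : ∀ᵐ x ∂μ, x ∈ space a) {s : Fin m → ℝ} (hs : ∀ j, 0 < s j)
    {ψ : Fin m → ℝ → ℂ} (hψ : ∀ j, ContinuousOn (ψ j) (Set.Icc 0 (s j)))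
    {σ : Measure ℝ} (hσ : IsSpectralMeasure (suspMeasure s μ) (flow s) (cylindrical ψ) σ)
    {ω : ℝ} {ξ : Fin m → ℝ} {z : Fin m → ℂ} (hξ : ∀ j, ∃ k : ℤ, ξ j = ω * s j + k)
    (hz : ∀ j, z j = fourierOn (s j) (ψ j) ω) {χ : ℝ} (hχ : 0 < χ)
    (hupper : upperExponent a ξ z = χ) {c : ℝ} (hc : 2 - 2 * χ / lam < c) :
    lowerLocalDim σ ω ≤ c := by
  have := hσ.finite
  obtain ⟨θ, δ, hθ, hθlam, hδ, hδχ, hI, hII⟩ := exists_small_parameters hlam hχ hc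
  set β := (χ + δ) / lam with hβdef
  set γ := (χ - δ) / β with hγdef
  set l := (lam + δ) * (1 + δ) with hldef
  set E := γ - l + 2 * (χ - δ) with hEdef
  have hβ : 0 < β := by positivity
  have hχδ : 0 < χ - δ := by linarith
  have hγ : 0 < γ := by positivity
  have hγl : γ ≤ l := by
    have h1 : γ ≤ lam := by
      rw [hγdef, hβdef, div_div_eq_mul_div, div_le_iff₀ (by positivity)]
      nlinarith
    have h2 : lam ≤ l := by rw [hldef]; nlinarith
    linarith
  obtain ⟨C₀, hC₀, hT⟩ := exists_norm_twistedSum_factor_le hadm hA1 hA2 hA3 hlam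
    (ξ := ξ) (z := z) (κ := χ + δ) (by linarith)
    (by rw [hupper]; exact_mod_cast (by linarith : χ < χ + δ))
  obtain ⟨C, hC, hB⟩ := exists_norm_integral_le hs hψ hξ hz hC₀ hβ hT
  obtain ⟨C₂, hC₂, hlen⟩ := exists_length_le hA2 hδ
  obtain ⟨s₀, M, hs₀, hM, hs₀s, hsM⟩ := exists_roof_bounds hs
  set S := ((μ.prod volume) (suspension s)).toReal with hS
  have hS0 : 0 < S := ENNReal.toReal_pos (prod_suspension_pos hs μ).ne'
    (prod_suspension_lt_top hs μ).ne
  set y := (1 / (4 * C)) ^ (1 / β) with hy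
  have hy0 : 0 < y := by positivity
  set d := y / (8 * (M + 1)) / (2 * C₂ + y) with hd
  have hd0 : 0 < d := by positivity
  set k₀ := s₀ * S⁻¹ * d / 4 with hk₀
  have hk₀0 : 0 < k₀ := by positivity
  set r : ℕ → ℝ := fun n => Real.exp (-((lam - θ) * n)) with hr
  have hr_tendsto : Tendsto r atTop (𝓝[>] 0) := by
    refine tendsto_nhdsWithin_iff.2 ⟨?_, Eventually.of_forall fun n => Real.exp_pos _⟩
    exact Real.tendsto_exp_neg_atTop_nhds_zero.comp
      (tendsto_natCast_atTop_atTop.const_mul_atTop (by linarith))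
  refine Filter.liminf_le_of_frequently_le' (hr_tendsto.frequently (p := fun r =>
    ENNReal.log (σ (Metric.ball ω r)) / ((Real.log r : ℝ) : EReal) ≤ c) ?_)
  have hfreq := frequently_lt_norm_cocycle (a := a) (ξ := ξ) (z := z) (κ := χ - δ)
    (by rw [hupper]; exact_mod_cast (by linarith : χ - δ < χ))
  -- the scale `y exp(γ n)` up to which the twisted integrals stay small must be large
  have hev1 := eventually_mul_exp_le hγ (8 * (M + 1)) hy0
  have hev2 := eventually_mul_exp_le hI (4 * (C * 2 ^ β) ^ 2) (half_pos hk₀0)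
  have hev3 := eventually_mul_exp_le (show 2 * (lam + δ) - c * (lam - θ) < E by linarith)
    ((M * C₂) ^ 2) (half_pos hk₀0)
  refine (hfreq.and_eventually ((eventually_exists_fullBlock hadm hA1 hδ).and
    (hev1.and (hev2.and (hev3.and (eventually_gt_atTop 0)))))).mono ?_
  rintro n ⟨hn, ⟨N, hnN, hN, hfull⟩, h1, h2, h3, hn0⟩
  have hn0' : (0 : ℝ) < n := by exact_mod_cast hn0
  have hpos : 0 < (lam - θ) * n := mul_pos (by linarith) hn0'
  refine log_div_log_le (Real.exp_pos _) (Real.exp_lt_one_iff.2 (by linarith)) ?_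
  obtain ⟨b, hb⟩ : ∃ b, Real.exp ((χ - δ) * n) < ‖(cocycle a ξ n).mulVec z b‖ := by
    by_contra! hcon
    exact absurd hn (not_lt.2 ((pi_norm_le_iff_of_nonneg (Real.exp_pos _).le).2 hcon))
  rw [← twistedSum_iter_word] at hb
  set w := (iter a n).word b with hw
  simp only [zero_mul, Real.exp_zero, mul_one] at h1
  set Y := y * Real.exp (γ * n) with hY
  have hY0 : 0 < Y := by positivity
  have hYβ : C * Y ^ β = Real.exp ((χ - δ) * n) / 4 := by
    rw [hY, hy, Real.mul_rpow (by positivity) (by positivity), ← Real.rpow_mul (by positivity),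
      ← Real.exp_mul, one_div_mul_cancel hβ.ne', Real.rpow_one, hγdef]
    have : (χ - δ) / β * n * β = (χ - δ) * n := by field_simp
    rw [this]
    field_simp
  set J := ⌊Y / (4 * (M + 1))⌋₊ with hJ
  have hJle : (J : ℝ) ≤ Y / (4 * (M + 1)) := Nat.floor_le (by positivity)
  have hJge : Y / (8 * (M + 1)) ≤ J := by
    have h4 := (Nat.sub_one_lt_floor (Y / (4 * (M + 1)))).le
    have h5 : 1 ≤ Y / (8 * (M + 1)) := by rwa [le_div_iff₀ (by positivity), one_mul]
    have h6 : Y / (4 * (M + 1)) = 2 * (Y / (8 * (M + 1))) := by field_simp; norm_num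
    rw [← hJ] at h4
    linarith
  have hJY : 1 + (J + 1) * M ≤ Y := by
    rw [le_div_iff₀ (by positivity)] at hJle
    nlinarith [(Nat.cast_nonneg J : (0 : ℝ) ≤ J)]
  -- frequency of the points that have seen `w` recently
  set L := 2 * ⌊C₂ * Real.exp (l * n)⌋₊ with hL
  have hLle : (L : ℝ) ≤ 2 * C₂ * Real.exp (l * n) := by
    rw [hL]
    push_cast
    have := Nat.floor_le (show 0 ≤ C₂ * Real.exp (l * n) by positivity)
    linarith
  have hocc (x : ℤ → Fin m) (hx : x ∈ space a) :
      ∃ j : ℕ, j < L ∧ factor x j w.length = w := by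
    obtain ⟨j, hj, hj'⟩ := exists_occurrence hadm hx hnN hfull
      (L := ⌊C₂ * Real.exp (l * n)⌋₊) (fun c => Nat.le_floor ((hlen N c).trans (by
        have : (lam + δ) * N ≤ l * n := by
          rw [hldef, mul_assoc]
          exact mul_le_mul_of_nonneg_left hN (by positivity)
        gcongr))) b 0
    exact ⟨j, hj, by rwa [zero_add] at hj'⟩
  have hfreqD := le_measure_recentOccurrence hμ hX hocc J
  set D := recentOccurrence w J with hD
  have hμD : d * Real.exp ((γ - l) * n) ≤ μ.real D := by
    have hLJ : (L : ℝ) + J ≤ (2 * C₂ + y) * Real.exp (l * n) := by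
      have h4 : (J : ℝ) ≤ y * Real.exp (l * n) := by
        refine hJle.trans ((div_le_self hY0.le (by linarith)).trans ?_)
        rw [hY]
        gcongr
      linarith
    have h5 : Y / (8 * (M + 1)) ≤ (2 * C₂ + y) * Real.exp (l * n) * μ.real D :=
      hJge.trans (hfreqD.trans (mul_le_mul_of_nonneg_right hLJ measureReal_nonneg))
    have h6 : d * Real.exp ((γ - l) * n) =
        Y / (8 * (M + 1)) / ((2 * C₂ + y) * Real.exp (l * n)) := by
      rw [hd, hY, sub_mul, Real.exp_sub]
      field_simp
    rw [h6, div_le_iff₀ (by positivity), mul_comm (μ.real D)]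
    exact h5
  set H := (w.map s).sum with hH
  have hH0 : 0 ≤ H := (mul_nonneg (Nat.cast_nonneg _) hs₀.le).trans (le_sum_map hs₀s w)
  have hHle : H ≤ M * C₂ * Real.exp ((lam + δ) * n) := by
    refine (sum_map_le hsM w).trans ?_
    rw [mul_comm, mul_assoc]
    exact mul_le_mul_of_nonneg_left (hlen n b) hM.le
  have hlarge : k₀ * Real.exp (E * n) ≤ meanSquare s ψ μ ω H := by
    have h4 := le_meanSquare hs hψ hs₀ hs₀s hX (measurableSet_recentOccurrence w J) (ω := ω)
      (R := H) (A := ‖twistedSum ξ z w‖ / 2) (by positivity) fun x hx hxD t ht ht' =>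
        half_le_norm_integral_of_recentOccurrence hs hsM hψ hξ hz hxD (fun t R hR hR' => by
          refine (hB x hx t R hR).trans ?_
          calc C * (1 + R) ^ β ≤ C * Y ^ β := by gcongr; linarith
            _ ≤ _ := by rw [hYβ]; linarith) ht ht'
    refine le_trans ?_ h4
    have h5 : k₀ * Real.exp (E * n) = s₀ * S⁻¹ * (d * Real.exp ((γ - l) * n)) *
        (Real.exp ((χ - δ) * n) / 2) ^ 2 := by
      have : Real.exp (E * n) = Real.exp ((γ - l) * n) * Real.exp ((χ - δ) * n) ^ 2 := by
        rw [← Real.exp_nat_mul, ← Real.exp_add, hEdef]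
        push_cast
        ring_nf
      rw [this, hk₀]
      ring
    rw [h5]
    gcongr
  have hball := meanSquare_le_ball hs hψ hμ hσ hX hC hβ hB hH0
    (Real.exp_pos ((lam - θ) * n))
  rw [one_div, ← Real.exp_neg] at hball
  have htail : 4 * (C * (1 + Real.exp ((lam - θ) * n)) ^ β) ^ 2 ≤
      k₀ / 2 * Real.exp (E * n) := by
    refine le_trans ?_ h2
    have h4 : (1 + Real.exp ((lam - θ) * n)) ^ β ≤ 2 ^ β * Real.exp ((lam - θ) * n) ^ β := by
      rw [← Real.mul_rpow (by norm_num) (Real.exp_pos _).le]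
      refine Real.rpow_le_rpow (by positivity) ?_ hβ.le
      linarith [Real.one_le_exp hpos.le]
    have h5 : Real.exp (2 * β * (lam - θ) * n) = (Real.exp ((lam - θ) * n) ^ β) ^ 2 := by
      rw [← Real.exp_mul, ← Real.exp_nat_mul]
      push_cast
      ring_nf
    rw [h5, mul_assoc 4, ← mul_pow, mul_assoc C]
    gcongr
  have hσ1 : k₀ / 2 * Real.exp (E * n) ≤
      (M * C₂ * Real.exp ((lam + δ) * n)) ^ 2 * σ.real (Metric.ball ω (r n)) := by
    have h4 : H ^ 2 * σ.real (Metric.ball ω (r n)) ≤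
        (M * C₂ * Real.exp ((lam + δ) * n)) ^ 2 * σ.real (Metric.ball ω (r n)) := by
      gcongr
    simp only [hr] at h4 ⊢
    linarith
  have h6 : (M * C₂ * Real.exp ((lam + δ) * n)) ^ 2 * r n ^ c =
      (M * C₂) ^ 2 * Real.exp ((2 * (lam + δ) - c * (lam - θ)) * n) := by
    simp only [hr]
    rw [mul_pow (M * C₂), mul_assoc, ← Real.exp_mul, ← Real.exp_nat_mul, ← Real.exp_add]
    push_cast
    ring_nf
  exact le_of_mul_le_mul_left (h6.trans_le (h3.trans hσ1)) (by positivity)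

end SAdic

theorem theorem4p2 {m : ℕ} (a : ℕ → SAdic.Subst m)
    (hadm : ∀ n, (a n).Admissible)
    (hA1 : SAdic.CondA1' a)
    (lam : ℝ) (hA2 : SAdic.CondA2 a lam)
    (hA3 : SAdic.CondA3 a)
    (haper : SAdic.Aperiodic a)
    (hrec : SAdic.Recognizable a)
    (μ : Measure (ℤ → Fin m)) (hμ : SAdic.IsInvariantProb a μ)
    (s : Fin m → ℝ) (hs : ∀ j, 0 < s j)
    (ψ : Fin m → ℝ → ℂ)
    (hψ : ∀ j, ∃ K, LipschitzOnWith K (ψ j) (Set.Icc 0 (s j)))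
    (σ : Measure ℝ)
    (hσ : SAdic.IsSpectralMeasure (SAdic.suspMeasure s μ) (SAdic.flow s)
      (SAdic.cylindrical ψ) σ)
    (ω : ℝ) (ξ : Fin m → ℝ) (hξ : ∀ j, ∃ k : ℤ, ξ j = ω * s j + k)
    (z : Fin m → ℂ) (hz : ∀ j, z j = SAdic.fourierOn (s j) (ψ j) ω) :
    (0 < SAdic.upperExponent a ξ z →
      SAdic.lowerLocalDim σ ω = 2 - 2 * SAdic.upperExponent a ξ z / (lam : EReal)) ∧
    (0 < lam → SAdic.upperExponent a ξ z ≤ 0 →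
      2 ≤ SAdic.lowerLocalDim σ ω) := by
  have : Nonempty (Fin m) := let ⟨b, _⟩ := (hadm 0).2; ⟨b⟩
  have := hμ.prob
  have hX : ∀ᵐ x ∂μ, x ∈ SAdic.space a := hμ.supported
  have hψ' (j : Fin m) : ContinuousOn (ψ j) (Set.Icc 0 (s j)) :=
    let ⟨_, hK⟩ := hψ j; hK.continuousOn
  have hlower (hlam : 0 < lam) (c : ℝ) (hc : c < 2)
      (h : SAdic.upperExponent a ξ z < (((2 - c) / 2 * lam : ℝ) : EReal)) :
      (c : EReal) ≤ SAdic.lowerLocalDim σ ω := by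
    have hβ : 0 < (2 - c) / 2 := by linarith
    obtain ⟨C₀, hC₀, hT⟩ :=
      SAdic.exists_norm_twistedSum_factor_le hadm hA1 hA2 hA3 hlam (mul_pos hβ hlam) h
    rw [mul_div_cancel_right₀ _ hlam.ne'] at hT
    obtain ⟨C, hC, hB⟩ := SAdic.exists_norm_integral_le hs hψ' hξ hz hC₀ hβ hT
    have := SAdic.le_lowerLocalDim hs hψ' hμ.invariant hσ hX hC hβ hB
    rwa [show 2 - 2 * ((2 - c) / 2) = c by ring] at this
  refine ⟨fun hpos => ?_, fun hlam hle => ?_⟩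
  · have hle := SAdic.upperExponent_le hA2 ξ z
    obtain ⟨χ, hχ⟩ : ∃ χ : ℝ, SAdic.upperExponent a ξ z = χ :=
      ⟨_, (EReal.coe_toReal (hle.trans_lt (EReal.coe_lt_top _)).ne
        ((EReal.bot_lt_zero).trans hpos).ne').symm⟩
    rw [hχ] at hpos hle
    have hχ0 : 0 < χ := by exact_mod_cast hpos
    have hχlam : χ ≤ lam := by exact_mod_cast hle
    have hlam : 0 < lam := hχ0.trans_le hχlam
    have hcoe : (2 : EReal) - 2 * SAdic.upperExponent a ξ z / (lam : EReal) =
        ((2 - 2 * χ / lam : ℝ) : EReal) := by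
      rw [hχ, EReal.coe_sub, EReal.coe_div, EReal.coe_mul]
      rfl
    rw [hcoe]
    refine le_antisymm ?_ ?_
    · refine EReal.le_of_forall_lt_iff_le.1 fun c hc => ?_
      exact SAdic.lowerLocalDim_le hadm hA1 hA2 hA3 hlam hμ.invariant hX hs hψ' hσ hξ hz hχ0 hχ
        (by exact_mod_cast hc)
    · refine EReal.ge_of_forall_gt_iff_ge.1 fun c hc => ?_
      have hc' : c < 2 - 2 * χ / lam := by exact_mod_cast hc
      have h1 : 2 * χ / lam < 2 - c := by linarith
      rw [div_lt_iff₀ hlam] at h1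
      refine hlower hlam c (by linarith [show 0 < 2 * χ / lam by positivity]) ?_
      rw [hχ]
      exact_mod_cast (by linarith : χ < (2 - c) / 2 * lam)
  · refine EReal.ge_of_forall_gt_iff_ge.1 fun c hc => ?_
    have hc' : c < 2 := EReal.coe_lt_coe_iff.1 hc
    refine hlower hlam c hc' (hle.trans_lt ?_)
    exact_mod_cast mul_pos (by linarith : 0 < (2 - c) / 2) hlam
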